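/- Let $R$ be a commutative Artinian ring and let $\Lambda$ and $\Gamma$ be Artin $R$-algebras (that is, $R$-algebras which are finitely generated as $R$-modules). Assume that $\Lambda$ and $\Gamma$ are symmetrically separably equivalent: there are bimodules ${}_\Lambda M_\Gamma$ and ${}_\Gamma N_\Lambda$, each finitely generated and projective as a left and as a right module, bimodules ${}_\Lambda X_\Lambda$ and ${}_\Gamma Y_\Gamma$, and bimodule isomorphisms $$M\otimes_\Gamma N\cong \Lambda\oplus X,\qquad N\otimes_\Lambda M\cong \Gamma\oplus Y,$$ such that both $(M\otimes_\Gamma-,\,N\otimes_\Lambda-)$ and $(N\otimes_\Lambda-,\,M\otimes_\Gamma-)$ are adjoint pairs of functors between the categories of left $\Lambda$-modules and left $\Gamma$-modules. For an Artin algebra $A$ let $0\to A\to I^0(A)\to I^1(A)\to\cdots$ be the minimal injective coresolution of the left module ${}_AA$. Then: 1. (Gorenstein symmetric conjecture) $\mathrm{id}\,{}_\Lambda\Lambda=\mathrm{id}\,\Lambda_\Lambda$ if and only if $\mathrm{id}\,{}_\Gamma\Gamma=\mathrm{id}\,\Gamma_\Gamma$, where $\mathrm{id}$ denotes the (possibly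 infinite) injective dimension. 2. (Strong Nakayama conjecture) $\Lambda$ satisfies the following condition if and only if $\Gamma$ does: every finitely generated left $A$-module $V$ with $\mathrm{Ext}_A^i(V,A)=0$ for all $i\ge 0$ is zero. 3. (Auslander–Gorenstein conjecture) $\Lambda$ satisfies the following condition if and only if $\Gamma$ does: if the flat dimension of the left $A$-module $I^i(A)$ is at most $i$ for all $i\ge0$ (the Auslander condition), then the injective dimensions of ${}_AA$ and of $A_A$ are both finite. 4. (Nakayama conjecture) $\Lambda$ satisfies the following condition if and only if $\Gamma$ does: if the dominant dimension of $A$ is infinite (where the dominant dimension is the least $n$ such that $I^n(A)$ is not projective, and $\infty$ if there is no such $n$), then $A$ is self-injective. -/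

import Mathlib

universe u

open CategoryTheory MulOpposite
open scoped TensorProduct

noncomputable section

/-! ## Tensor product over a noncommutative ring -/

/-- The relations `(m b) ⊗ v = m ⊗ (b v)` inside `M ⊗[ℤ] V`. -/
def balancedRel (B : Type u) [Ring B] (M V : Type u) [AddCommGroup M] [Module Bᵐᵒᵖ M]
    [AddCommGroup V] [Module B V] : AddSubgroup (M ⊗[ℤ] V) :=
  AddSubgroup.closure {t | ∃ (m : M) (b : B) (v : V), t = (op b • m) ⊗ₜ[ℤ] v - m ⊗ₜ[ℤ] (b • v)}

/-- The tensor product `M ⊗_B V` of a right `B`-module `M` and a left `B`-module `V` over a not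
necessarily commutative ring `B`. Right `B`-modules are `Bᵐᵒᵖ`-modules. -/
def BalancedTensor (B : Type u) [Ring B] (M V : Type u) [AddCommGroup M] [Module Bᵐᵒᵖ M]
    [AddCommGroup V] [Module B V] : Type u :=
  (M ⊗[ℤ] V) ⧸ balancedRel B M V

namespace BalancedTensor

section

variable (B : Type u) [Ring B] (M V : Type u) [AddCommGroup M] [Module Bᵐᵒᵖ M]
    [AddCommGroup V] [Module B V]

instance : AddCommGroup (BalancedTensor B M V) :=
  inferInstanceAs (AddCommGroup ((M ⊗[ℤ] V) ⧸ balancedRel B M V))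

variable {M V}

/-- The elementary tensor `m ⊗ v` in `M ⊗_B V`. -/
def tmul (m : M) (v : V) : BalancedTensor B M V :=
  QuotientAddGroup.mk (s := balancedRel B M V) (m ⊗ₜ[ℤ] v)

theorem smul_tmul (m : M) (b : B) (v : V) :
    tmul B (op b • m) v = tmul B m (b • v) := by
  refine (QuotientAddGroup.eq_iff_sub_mem (N := balancedRel B M V)).2 ?_
  exact AddSubgroup.subset_closure ⟨m, b, v, rfl⟩

variable {B}

@[elab_as_elim]
theorem induction_on {p : BalancedTensor B M V → Prop} (t : BalancedTensor B M V)
    (tmul : ∀ m v, p (tmul B m v)) (add : ∀ x y, p x → p y → p (x + y)) : p t := by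
  obtain ⟨t, rfl⟩ := QuotientAddGroup.mk_surjective t
  induction t with
  | zero =>
    have h := tmul 0 0
    rwa [BalancedTensor.tmul, TensorProduct.zero_tmul] at h
  | tmul m v => exact tmul m v
  | add x y hx hy => exact add _ _ hx hy

theorem hom_ext {P : Type*} [AddCommGroup P] {f g : BalancedTensor B M V →+ P}
    (h : ∀ m v, f (tmul B m v) = g (tmul B m v)) : f = g := by
  ext t
  induction t using induction_on with
  | tmul m v => exact h m v
  | add x y hx hy => rw [map_add, map_add, hx, hy]

variable {M' V' M'' V'' : Type u} [AddCommGroup M'] [Module Bᵐᵒᵖ M'] [AddCommGroup V']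
  [Module B V'] [AddCommGroup M''] [Module Bᵐᵒᵖ M''] [AddCommGroup V''] [Module B V'']

/-- The additive map `f ⊗ g` induced by a right linear `f` and a left linear `g`. -/
def map (f : M →ₗ[Bᵐᵒᵖ] M') (g : V →ₗ[B] V') :
    BalancedTensor B M V →+ BalancedTensor B M' V' :=
  QuotientAddGroup.map (balancedRel B M V) (balancedRel B M' V')
    (TensorProduct.map f.toAddMonoidHom.toIntLinearMap
      g.toAddMonoidHom.toIntLinearMap).toAddMonoidHom (by
    rw [balancedRel, AddSubgroup.closure_le]
    rintro _ ⟨m, b, v, rfl⟩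
    refine AddSubgroup.subset_closure ⟨f m, b, g v, ?_⟩
    simp)

@[simp]
theorem map_tmul (f : M →ₗ[Bᵐᵒᵖ] M') (g : V →ₗ[B] V') (m : M) (v : V) :
    map f g (tmul B m v) = tmul B (f m) (g v) := rfl

theorem map_id : map (LinearMap.id : M →ₗ[Bᵐᵒᵖ] M) (LinearMap.id : V →ₗ[B] V) =
    AddMonoidHom.id _ := hom_ext fun _ _ ↦ rfl

theorem map_comp (f' : M' →ₗ[Bᵐᵒᵖ] M'') (g' : V' →ₗ[B] V'') (f : M →ₗ[Bᵐᵒᵖ] M')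
    (g : V →ₗ[B] V') : map (f' ∘ₗ f) (g' ∘ₗ g) = (map f' g').comp (map f g) :=
  hom_ext fun _ _ ↦ rfl

theorem tmul_add (m : M) (v w : V) : tmul B m (v + w) = tmul B m v + tmul B m w :=
  congrArg (QuotientAddGroup.mk (s := balancedRel B M V)) (TensorProduct.tmul_add m v w)

theorem add_tmul (m n : M) (v : V) : tmul B (m + n) v = tmul B m v + tmul B n v :=
  congrArg (QuotientAddGroup.mk (s := balancedRel B M V)) (TensorProduct.add_tmul m n v)

theorem tmul_zero (m : M) : tmul B m (0 : V) = 0 :=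
  congrArg (QuotientAddGroup.mk (s := balancedRel B M V)) (TensorProduct.tmul_zero V m)

theorem zero_tmul (v : V) : tmul B (0 : M) v = 0 :=
  congrArg (QuotientAddGroup.mk (s := balancedRel B M V)) (TensorProduct.zero_tmul M v)

end

section

variable {A B C : Type u} [Ring A] [Ring B] [Ring C]

/-- If `M` is an `(A, B)`-bimodule, then `M ⊗_B V` is a left `A`-module by `a (m ⊗ v) = (a m) ⊗ v`. -/
instance leftModule (M V : Type u) [AddCommGroup M] [Module A M] [Module Bᵐᵒᵖ M]
    [SMulCommClass A Bᵐᵒᵖ M] [AddCommGroup V] [Module B V] :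
    Module A (BalancedTensor B M V) where
  smul a t := map (DistribSMul.toLinearMap Bᵐᵒᵖ M a) LinearMap.id t
  one_smul t := DFunLike.congr_fun (g := AddMonoidHom.id _)
    (hom_ext fun m v ↦ congrArg (tmul B · v) (one_smul A m)) t
  mul_smul a b t := DFunLike.congr_fun
    (f := map (DistribSMul.toLinearMap Bᵐᵒᵖ M (a * b)) LinearMap.id)
    (g := (map (DistribSMul.toLinearMap Bᵐᵒᵖ M a) LinearMap.id).comp
      (map (DistribSMul.toLinearMap Bᵐᵒᵖ M b) LinearMap.id))
    (hom_ext fun m v ↦ congrArg (tmul B · v) (mul_smul a b m)) t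
  smul_zero _ := _root_.map_zero _
  smul_add _ := _root_.map_add _
  add_smul a b t := DFunLike.congr_fun
    (f := map (DistribSMul.toLinearMap Bᵐᵒᵖ M (a + b)) LinearMap.id)
    (g := map (DistribSMul.toLinearMap Bᵐᵒᵖ M a) LinearMap.id +
      map (DistribSMul.toLinearMap Bᵐᵒᵖ M b) LinearMap.id)
    (hom_ext fun m v ↦ (congrArg (tmul B · v) (add_smul a b m)).trans (add_tmul _ _ v)) t
  zero_smul t := DFunLike.congr_fun
    (f := map (DistribSMul.toLinearMap Bᵐᵒᵖ M (0 : A)) LinearMap.id) (g := 0)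
    (hom_ext fun m v ↦ (congrArg (tmul B · v) (zero_smul A m)).trans (zero_tmul v)) t

/-- If `V` is a `(B, C)`-bimodule, then `M ⊗_B V` is a right `C`-module by `(m ⊗ v) c = m ⊗ (v c)`.
This is not a global instance. -/
abbrev rightModule (M V : Type u) [AddCommGroup M] [Module Bᵐᵒᵖ M]
    [AddCommGroup V] [Module B V] [Module Cᵐᵒᵖ V] [SMulCommClass B Cᵐᵒᵖ V] :
    Module Cᵐᵒᵖ (BalancedTensor B M V) :=
  letI : SMulCommClass Cᵐᵒᵖ B V := SMulCommClass.symm _ _ _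
  { smul := fun c t ↦ map LinearMap.id (DistribSMul.toLinearMap B V c) t
    one_smul := fun t ↦ DFunLike.congr_fun (g := AddMonoidHom.id _)
      (hom_ext fun m v ↦ congrArg (tmul B m) (one_smul Cᵐᵒᵖ v)) t
    mul_smul := fun a b t ↦ DFunLike.congr_fun
      (f := map LinearMap.id (DistribSMul.toLinearMap B V (a * b)))
      (g := (map LinearMap.id (DistribSMul.toLinearMap B V a)).comp
        (map LinearMap.id (DistribSMul.toLinearMap B V b)))
      (hom_ext fun m v ↦ congrArg (tmul B m) (mul_smul a b v)) t
    smul_zero := fun _ ↦ _root_.map_zero _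
    smul_add := fun _ ↦ _root_.map_add _
    add_smul := fun a b t ↦ DFunLike.congr_fun
      (f := map LinearMap.id (DistribSMul.toLinearMap B V (a + b)))
      (g := map LinearMap.id (DistribSMul.toLinearMap B V a) +
        map LinearMap.id (DistribSMul.toLinearMap B V b))
      (hom_ext fun m v ↦ (congrArg (tmul B m) (add_smul a b v)).trans (tmul_add m _ _)) t
    zero_smul := fun t ↦ DFunLike.congr_fun
      (f := map LinearMap.id (DistribSMul.toLinearMap B V (0 : Cᵐᵒᵖ))) (g := 0)
      (hom_ext fun m v ↦ (congrArg (tmul B m) (zero_smul Cᵐᵒᵖ v)).trans (tmul_zero m)) t }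

end

end BalancedTensor

/-! ## Bimodules and separable equivalences -/

/-- `(A, B)`-bimodules: a left `A`-module and right `B`-module structure which commute. -/
structure Bimodule (A B : Type u) [Ring A] [Ring B] where
  carrier : Type u
  [addCommGroup : AddCommGroup carrier]
  [left : Module A carrier]
  [right : Module Bᵐᵒᵖ carrier]
  [comm : SMulCommClass A Bᵐᵒᵖ carrier]

namespace Bimodule

instance (A B : Type u) [Ring A] [Ring B] : CoeSort (Bimodule A B) (Type u) := ⟨carrier⟩

attribute [instance] addCommGroup left right comm

variable {A B C : Type u} [Ring A] [Ring B] [Ring C]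

/-- The regular `(A, A)`-bimodule. -/
abbrev regular (A : Type u) [Ring A] : Bimodule A A where
  carrier := A

/-- The direct sum of two bimodules. -/
abbrev directSum (M N : Bimodule A B) : Bimodule A B where
  carrier := M × N

/-- The bimodule `M ⊗_B N`. -/
def tensor (M : Bimodule A B) (N : Bimodule B C) : Bimodule A C :=
  letI := BalancedTensor.rightModule (B := B) (C := C) M N
  { carrier := BalancedTensor B M N
    comm := ⟨fun a c t ↦ by
      induction t using BalancedTensor.induction_on with
      | tmul m v => rfl
      | add x y hx hy => simp only [smul_add, hx, hy]⟩ }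

/-- There is an isomorphism of bimodules between `M` and `N`. -/
def Isomorphic (M N : Bimodule A B) : Prop :=
  ∃ e : M ≃ₗ[A] N, ∀ (b : B) (x : M), e (op b • x) = op b • e x

/-- `M` is finitely generated projective as a left and as a right module. -/
structure IsFGProjectiveOneSided (M : Bimodule A B) : Prop where
  finite_left : Module.Finite A M
  projective_left : Module.Projective A M
  finite_right : Module.Finite Bᵐᵒᵖ M
  projective_right : Module.Projective Bᵐᵒᵖ M

/-- The functor `M ⊗_B - : Mod B ⥤ Mod A`. -/
def tensorFunctor (M : Bimodule A B) : ModuleCat.{u} B ⥤ ModuleCat.{u} A where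
  obj V := ModuleCat.of A (BalancedTensor B M V)
  map {V W} f := ModuleCat.ofHom
    { toFun := BalancedTensor.map (LinearMap.id : M →ₗ[Bᵐᵒᵖ] M) f.hom
      map_add' := map_add _
      map_smul' := fun a t ↦ by
        induction t using BalancedTensor.induction_on with
        | tmul m v => rfl
        | add x y hx hy => simp only [smul_add, map_add, hx, hy] }
  map_id V := by
    ext t
    exact DFunLike.congr_fun BalancedTensor.map_id t
  map_comp f g := by
    ext t
    exact DFunLike.congr_fun (BalancedTensor.map_comp LinearMap.id g.hom LinearMap.id f.hom) t

end Bimodule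

/-- `A` and `B` are separably equivalent, induced by the bimodules `M` and `N`. -/
structure IsSeparablyEquivalentBy {A B : Type u} [Ring A] [Ring B] (M : Bimodule A B)
    (N : Bimodule B A) : Prop where
  fg_projective_fst : M.IsFGProjectiveOneSided
  fg_projective_snd : N.IsFGProjectiveOneSided
  exists_left : ∃ X : Bimodule A A,
    (M.tensor N).Isomorphic ((Bimodule.regular A).directSum X)
  exists_right : ∃ Y : Bimodule B B,
    (N.tensor M).Isomorphic ((Bimodule.regular B).directSum Y)

/-- `A` and `B` are symmetrically separably equivalent: they are separably equivalent, induced by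
bimodules `M` and `N` such that `(M ⊗_B -, N ⊗_A -)` and `(N ⊗_A -, M ⊗_B -)` are adjoint pairs. -/
def SymmetricallySeparablyEquivalent (A B : Type u) [Ring A] [Ring B] : Prop :=
  ∃ (M : Bimodule A B) (N : Bimodule B A), IsSeparablyEquivalentBy M N ∧
    Nonempty (M.tensorFunctor ⊣ N.tensorFunctor) ∧ Nonempty (N.tensorFunctor ⊣ M.tensorFunctor)

/-! ## Minimal injective coresolutions, flat dimension, dominant dimension -/

/-- A submodule `S` of `V` is essential if it meets every nonzero submodule nontrivially. -/
def Submodule.IsEssentialSubmodule {A V : Type u} [Ring A] [AddCommGroup V] [Module A V]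
    (S : Submodule A V) : Prop :=
  ∀ T : Submodule A V, S ⊓ T = ⊥ → T = ⊥

/-- An injective coresolution `0 → V → I⁰ → I¹ → ⋯` is minimal if each `Iⁿ` is an injective
envelope of the kernel of `Iⁿ → Iⁿ⁺¹`, which is (the image of) `V` for `n = 0` and the image of
`Iⁿ⁻¹ → Iⁿ` for `n ≥ 1`. -/
def IsMinimalInjectiveResolution {A : Type u} [Ring A] {V : ModuleCat.{u} A}
    (I : InjectiveResolution V) : Prop :=
  ∀ n : ℕ, (LinearMap.ker (I.cocomplex.d n (n + 1)).hom).IsEssentialSubmodule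

/-- A left `A`-module `F` is flat if `- ⊗_A F` preserves injections of right `A`-modules. -/
def IsFlatModule (A F : Type u) [Ring A] [AddCommGroup F] [Module A F] : Prop :=
  ∀ ⦃K L : Type u⦄ [AddCommGroup K] [AddCommGroup L] [Module Aᵐᵒᵖ K] [Module Aᵐᵒᵖ L]
    (f : K →ₗ[Aᵐᵒᵖ] L), Function.Injective f →
      Function.Injective (BalancedTensor.map f (LinearMap.id : F →ₗ[A] F))

/-- `fd V ≤ n`: there is an exact sequence `0 → Fₙ → ⋯ → F₁ → F₀ → V → 0` with all `Fᵢ` flat. -/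
def HasFlatDimensionLE (A V : Type u) [Ring A] [AddCommGroup V] [Module A V] (n : ℕ) : Prop :=
  ∃ (F : ℕ → ModuleCat.{u} A) (d : ∀ i, F (i + 1) →ₗ[A] F i) (ε : F 0 →ₗ[A] V),
    (∀ i, IsFlatModule A (F i)) ∧ (∀ i, n < i → Subsingleton (F i)) ∧
    Function.Surjective ε ∧ Function.Exact (d 0) ε ∧
    ∀ i, Function.Exact (d (i + 1)) (d i)

section Conjectures

variable (A : Type u) [Ring A]

/-- `A` is `n`-Gorenstein: `fd Iⁱ ≤ i` for `0 ≤ i ≤ n - 1`, where `I` is the minimal injective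
coresolution of the left module `A` (which exists and is unique up to isomorphism). -/
def IsNGorenstein (n : ℕ) : Prop :=
  ∀ I : InjectiveResolution (ModuleCat.of A A), IsMinimalInjectiveResolution I →
    ∀ i < n, HasFlatDimensionLE A (I.cocomplex.X i) i

/-- `A` satisfies the Auslander condition if it is `n`-Gorenstein for all positive `n`. -/
def SatisfiesAuslanderCondition : Prop := ∀ n : ℕ, 0 < n → IsNGorenstein A n

/-- The dominant dimension of `A`: the minimal `n` such that `Iⁿ` is not projective, where `I` is
the minimal injective coresolution of the left module `A`, and `∞` if there is no such `n`. -/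
def dominantDimension : ℕ∞ :=
  sInf {k | ∃ (n : ℕ) (I : InjectiveResolution (ModuleCat.of A A)),
    IsMinimalInjectiveResolution I ∧ ¬ Module.Projective A (I.cocomplex.X n) ∧ k = n}

/-- The injective dimension of `A` as a left module over itself. -/
def leftSelfInjectiveDimension : WithBot ℕ∞ := injectiveDimension (ModuleCat.of A A)

/-- The injective dimension of `A` as a right module over itself. -/
def rightSelfInjectiveDimension : WithBot ℕ∞ := injectiveDimension (ModuleCat.of Aᵐᵒᵖ A)

/-- The left and right self-injective dimensions of `A` are finite. -/
def IsGorensteinAlgebra : Prop :=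
  leftSelfInjectiveDimension A ≠ ⊤ ∧ rightSelfInjectiveDimension A ≠ ⊤

/-- `A` satisfies the Gorenstein symmetric conjecture. -/
def SatisfiesGorensteinSymmetricConjecture : Prop :=
  leftSelfInjectiveDimension A = rightSelfInjectiveDimension A

/-- `A` satisfies the strong Nakayama conjecture: a finitely generated left `A`-module `V` with
`Extⁱ(V, A) = 0` for all `i ≥ 0` is zero. -/
def SatisfiesStrongNakayamaConjecture : Prop :=
  ∀ V : ModuleCat.{u} A, Module.Finite A V →
    (∀ i : ℕ, Subsingleton (Abelian.Ext V (ModuleCat.of A A) i)) → Subsingleton V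

/-- `A` satisfies the Auslander–Gorenstein conjecture. -/
def SatisfiesAuslanderGorensteinConjecture : Prop :=
  SatisfiesAuslanderCondition A → IsGorensteinAlgebra A

/-- `A` satisfies the Nakayama conjecture. -/
def SatisfiesNakayamaConjecture : Prop :=
  dominantDimension A = ⊤ → Module.Injective A A

end Conjectures

end

/-! Write D for `Hom(-, ℚ/ℤ)`, and let `A`, `B` be the two algebras. Since `M ⊗ -` and `N ⊗ -` are
adjoint on both sides, `M ⊗ -` is exact and preserves injectives and projectives; it preserves flat
modules because `M` is projective on the left (`tensorFunctor_isHomologicalTransfer`). The same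
holds for H = M ⊗ (-)ⁿ. As `N` is a summand of Bⁿ, the module M ⊗ N, and with it `A`, is a summand
of H(B) (`exists_transfer`).

Left side: applying H bounds id of the left module `A` by that of `B`. It also sends an injective
coresolution of `B` to one of H(B), and a minimal coresolution of `A` is termwise a summand of it
(`isRetract_minimal`). Flatness bounds and projectivity of the terms therefore pass from `B` to `A`,
which handles the Auslander condition and infinite dominant dimension.

Right side: the adjunctions concern left modules only, so right modules are replaced by their
characters. Over a right noetherian ring, id of the right module `A` equals the flat dimension of
the left module D(A) (`hasInjectiveDimensionLT_right_iff`), because V and DDV have the same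
injective dimension. The unit and counit of the adjunction make D(M ⊗ N) a summand of M ⊗ D(M)
(`isRetract_rightDual_tensor`); since `M` is a summand of Bⁿ on the right, D(A) is a summand of
H(D(B)).

Strong Nakayama: Ext(M ⊗ V, A) and Ext(V, N ⊗ A) vanish together
(`subsingleton_ext_iff_of_adjunction`), and N ⊗ A ≅ N is a summand of Bⁿ. So if all Ext(V, B)
vanish, the condition on `A` gives M ⊗ V = 0, and V = 0 because V is a summand of N ⊗ M ⊗ V. The
hypothesis is symmetric in `A` and `B`, so each transfer yields an equivalence. -/

open CategoryTheory MulOpposite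
open scoped TensorProduct

noncomputable section

/-! ## Character modules over noncommutative rings -/

/-- The character module `Hom(V, ℚ/ℤ)` of an `S`-module `V`, regarded as a module over a ring `T`
which is identified with the opposite of `S`. -/
def DualModule {S T : Type u} [Ring S] [Ring T] (_e : T ≃+* Sᵐᵒᵖ) (V : Type u) [AddCommGroup V]
    [Module S V] : Type u :=
  V →+ AddCircle (1 : ℚ)

namespace DualModule

section

variable {S T : Type u} [Ring S] [Ring T] (e : T ≃+* Sᵐᵒᵖ)
variable (V : Type u) [AddCommGroup V] [Module S V]
variable {W : Type u} [AddCommGroup W] [Module S W]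
variable {U : Type u} [AddCommGroup U] [Module S U]

instance : AddCommGroup (DualModule e V) :=
  inferInstanceAs (AddCommGroup (V →+ AddCircle (1 : ℚ)))

instance : FunLike (DualModule e V) V (AddCircle (1 : ℚ)) :=
  inferInstanceAs (FunLike (V →+ AddCircle (1 : ℚ)) V (AddCircle (1 : ℚ)))

instance : AddMonoidHomClass (DualModule e V) V (AddCircle (1 : ℚ)) :=
  inferInstanceAs (AddMonoidHomClass (V →+ AddCircle (1 : ℚ)) V (AddCircle (1 : ℚ)))

variable {V}

/-- Regard an additive character as an element of the dual module. -/
def ofHom (χ : V →+ AddCircle (1 : ℚ)) : DualModule e V := χ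

variable {e}

@[simp]
theorem ofHom_apply (χ : V →+ AddCircle (1 : ℚ)) (v : V) : ofHom e χ v = χ v := rfl

@[ext]
theorem ext {χ ψ : DualModule e V} (h : ∀ v, χ v = ψ v) : χ = ψ := DFunLike.ext _ _ h

@[simp]
theorem add_apply (χ ψ : DualModule e V) (v : V) : (χ + ψ) v = χ v + ψ v := rfl

theorem sum_apply {ι : Type*} (s : Finset ι) (φ : ι → DualModule e V) (v : V) :
    (∑ i ∈ s, φ i) v = ∑ i ∈ s, φ i v := by
  classical
  induction s using Finset.induction_on with
  | empty => rfl
  | insert a s ha ih => rw [Finset.sum_insert ha, Finset.sum_insert ha, add_apply, ih]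

@[simp]
theorem zero_apply (v : V) : (0 : DualModule e V) v = 0 := rfl

instance : Module T (DualModule e V) where
  smul t χ := ofHom e ((χ : V →+ AddCircle (1 : ℚ)).comp (DistribSMul.toAddMonoidHom V (e t).unop))
  one_smul χ := by
    ext v
    change χ ((e 1).unop • v) = χ v
    simp
  mul_smul t t' χ := by
    ext v
    change χ ((e (t * t')).unop • v) = χ ((e t').unop • (e t).unop • v)
    rw [map_mul, unop_mul, mul_smul]
  smul_zero _ := rfl
  smul_add _ _ _ := rfl
  add_smul t t' χ := by
    ext v
    change χ ((e (t + t')).unop • v) = χ ((e t).unop • v) + χ ((e t').unop • v)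
    rw [map_add e]
    exact (congrArg χ (add_smul _ _ v)).trans (map_add χ _ _)
  zero_smul χ := by
    ext v
    change χ ((e 0).unop • v) = 0
    simp

theorem smul_apply (t : T) (χ : DualModule e V) (v : V) : (t • χ) v = χ ((e t).unop • v) := rfl

variable (e)

/-- The transpose of a linear map. -/
def map (f : V →ₗ[S] W) : DualModule e W →ₗ[T] DualModule e V where
  toFun χ := ofHom e ((χ : W →+ AddCircle (1 : ℚ)).comp f.toAddMonoidHom)
  map_add' _ _ := rfl
  map_smul' t χ := by
    ext v
    exact congrArg χ (f.map_smul _ v).symm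

variable {e}

@[simp]
theorem map_apply (f : V →ₗ[S] W) (χ : DualModule e W) (v : V) : map e f χ v = χ (f v) := rfl

theorem map_id : map e (LinearMap.id : V →ₗ[S] V) = LinearMap.id := rfl

theorem map_comp (g : W →ₗ[S] U) (f : V →ₗ[S] W) : map e (g ∘ₗ f) = map e f ∘ₗ map e g := rfl

end

/-! ### Exactness of characters of abelian groups -/

section

variable {V W U : Type*} [AddCommGroup V] [AddCommGroup W] [AddCommGroup U]

theorem exists_character_extension (f : V →+ W) (hf : Function.Injective f)
    (χ : V →+ AddCircle (1 : ℚ)) : ∃ ψ : W →+ AddCircle (1 : ℚ), ψ.comp f = χ :=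
  (Module.Baer.of_divisible _).extension_property_addMonoidHom _ hf _

theorem exists_character_ne_zero {w : W} (hw : w ≠ 0) : ∃ χ : W →+ AddCircle (1 : ℚ), χ w ≠ 0 :=
  CharacterModule.exists_character_apply_ne_zero_of_ne_zero hw

theorem exists_character_separating (H : AddSubgroup W) {w : W} (hw : w ∉ H) :
    ∃ χ : W →+ AddCircle (1 : ℚ), (∀ h ∈ H, χ h = 0) ∧ χ w ≠ 0 := by
  obtain ⟨χ, hχ⟩ := exists_character_ne_zero (w := (QuotientAddGroup.mk w : W ⧸ H))
    (fun h ↦ hw ((QuotientAddGroup.eq_zero_iff w).1 h))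
  exact ⟨χ.comp (QuotientAddGroup.mk' H),
    fun h hh ↦ by simp [(QuotientAddGroup.eq_zero_iff h).2 hh], hχ⟩

/-- A character vanishing on the kernel of `g` factors through `g`. -/
theorem exists_character_factor (g : W →+ U) (χ : W →+ AddCircle (1 : ℚ))
    (h : ∀ w, g w = 0 → χ w = 0) : ∃ ψ : U →+ AddCircle (1 : ℚ), ψ.comp g = χ := by
  obtain ⟨ψ, hψ⟩ := exists_character_extension (QuotientAddGroup.kerLift g)
    (QuotientAddGroup.kerLift_injective g) (QuotientAddGroup.lift g.ker χ h)
  refine ⟨ψ, ?_⟩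
  ext w
  exact DFunLike.congr_fun hψ (w : W ⧸ g.ker)

/-- `ℚ/ℤ` is an injective cogenerator: characters killing `ker g` extend to factor through `g`, and
a character separating a point of `ker g` from the image of `f` could not factor through `g`. -/
theorem exact_character_iff (f : V →+ W) (g : W →+ U) :
    (Function.Exact (fun χ : U →+ AddCircle (1 : ℚ) ↦ χ.comp g) (fun χ ↦ χ.comp f)) ↔
      Function.Exact f g := by
  constructor
  · intro h w
    constructor
    · intro hw
      by_contra hn
      obtain ⟨χ, h0, hχ⟩ := exists_character_separating f.range (w := w) hn
      obtain ⟨ψ, rfl⟩ := (h χ).1 (by ext v; exact h0 _ ⟨v, rfl⟩)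
      exact hχ (by simp [hw])
    · rintro ⟨v, rfl⟩
      by_contra hn
      obtain ⟨χ, hχ⟩ := exists_character_ne_zero hn
      exact hχ (DFunLike.congr_fun ((h (χ.comp g)).2 ⟨χ, rfl⟩) v)
  · intro h χ
    constructor
    · intro hχ
      refine exists_character_factor g χ fun w hw ↦ ?_
      obtain ⟨v, rfl⟩ := (h w).1 hw
      exact DFunLike.congr_fun hχ v
    · rintro ⟨ψ, rfl⟩
      ext v
      simp [h.apply_apply_eq_zero]

end

section

variable {S T : Type u} [Ring S] [Ring T] (e : T ≃+* Sᵐᵒᵖ)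
variable {V : Type u} [AddCommGroup V] [Module S V]
variable {W : Type u} [AddCommGroup W] [Module S W]
variable {U : Type u} [AddCommGroup U] [Module S U]

theorem map_exact_iff (f : V →ₗ[S] W) (g : W →ₗ[S] U) :
    Function.Exact (map e g) (map e f) ↔ Function.Exact f g :=
  exact_character_iff f.toAddMonoidHom g.toAddMonoidHom

theorem map_surjective {f : V →ₗ[S] W} (hf : Function.Injective f) :
    Function.Surjective (map e f) :=
  fun χ ↦ exists_character_extension f.toAddMonoidHom hf χ

theorem map_injective {f : V →ₗ[S] W} (hf : Function.Surjective f) :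
    Function.Injective (map e f) := by
  intro χ ψ h
  ext w
  obtain ⟨v, rfl⟩ := hf w
  exact DFunLike.congr_fun h v

theorem subsingleton_iff : Subsingleton (DualModule e V) ↔ Subsingleton V := by
  constructor
  · intro h
    refine subsingleton_of_forall_eq 0 fun v ↦ ?_
    by_contra hv
    obtain ⟨χ, hχ⟩ := exists_character_ne_zero hv
    exact hχ (DFunLike.congr_fun (Subsingleton.elim (ofHom e χ) 0) v)
  · intro h
    refine subsingleton_of_forall_eq 0 fun χ ↦ ?_
    ext v
    rw [Subsingleton.elim v 0, map_zero, zero_apply]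

/-- The dual of a finite power. -/
def piEquiv (n : ℕ) : DualModule e (Fin n → V) ≃ₗ[T] (Fin n → DualModule e V) where
  toFun χ i := map e (LinearMap.single S (fun _ ↦ V) i) χ
  invFun χ := ∑ i, map e (LinearMap.proj i) (χ i)
  map_add' _ _ := rfl
  map_smul' _ _ := by
    ext
    simp
  left_inv χ := by
    ext v
    rw [sum_apply]
    simp only [map_apply, LinearMap.coe_proj, Function.eval, LinearMap.coe_single]
    rw [← map_sum, Finset.univ_sum_single]
  right_inv χ := by
    ext j v
    rw [map_apply, sum_apply, Finset.sum_eq_single j]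
    · simp
    · intro i _ hij
      simp [hij]
    · simp

end

/-! ### Adjointness -/

section

variable {S T : Type u} [Ring S] [Ring T] (e : T ≃+* Sᵐᵒᵖ)
variable {P : Type u} [AddCommGroup P] [Module S P]

/-- The dual of a projective module is injective. -/
theorem injective_of_projective [Module.Projective S P] : Module.Injective T (DualModule e P) where
  out K L _ _ _ _ f hf g := by
    let e' : S ≃+* Tᵐᵒᵖ := (RingEquiv.opOp S).trans (RingEquiv.op e.symm)
    have he' (s : S) : e (e' s).unop = op s := by simp [e']
    -- Swapping arguments turns the extension of `g` along `f` into a lifting problem for `P` along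
    -- D(L) → D(K), which is surjective.
    let g' : P →ₗ[S] DualModule e' K :=
      { toFun p := ofHom e'
          { toFun k := g k p
            map_zero' := by simp
            map_add' _ _ := by simp }
        map_add' p q := by ext k; simp
        map_smul' s p := by
          ext k
          simp [smul_apply, he'] }
    obtain ⟨h', hh'⟩ := Module.projective_lifting_property (map e' f) g' (map_surjective e' hf)
    refine ⟨{ toFun l := ofHom e
                { toFun p := h' p l
                  map_zero' := by simp
                  map_add' _ _ := by simp }
              map_add' l m := by ext p; simp
              map_smul' t l := by
                ext p
                have : e' (e t).unop = op t := by simp [e']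
                simp [smul_apply, this] }, fun k ↦ ?_⟩
    ext p
    exact DFunLike.congr_fun (DFunLike.congr_fun hh' p) k

end

end DualModule

/-! ### Balanced maps, and flatness by characters -/

namespace BalancedTensor

variable {B : Type u} [Ring B] {M V : Type u} [AddCommGroup M] [Module Bᵐᵒᵖ M]
    [AddCommGroup V] [Module B V]

/-- The additive map out of `M ⊗_B V` induced by a balanced biadditive map. -/
def lift {P : Type*} [AddCommGroup P] (f : M →+ V →+ P)
    (hf : ∀ m (b : B) v, f (op b • m) v = f m (b • v)) : BalancedTensor B M V →+ P :=
  QuotientAddGroup.lift (balancedRel B M V)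
    (TensorProduct.liftAddHom f (fun r m v ↦ by simp)) (by
      rw [balancedRel, AddSubgroup.closure_le]
      rintro _ ⟨m, b, v, rfl⟩
      change TensorProduct.liftAddHom f _ _ = 0
      rw [map_sub]
      simp [hf])

@[simp]
theorem lift_tmul {P : Type*} [AddCommGroup P] (f : M →+ V →+ P)
    (hf : ∀ m (b : B) v, f (op b • m) v = f m (b • v)) (m : M) (v : V) :
    lift f hf (tmul B m v) = f m v := rfl

/-- The additive map `v ↦ m ⊗ v` depending additively on `m`. -/
def mk : M →+ V →+ BalancedTensor B M V where
  toFun m :=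
    { toFun := tmul B m
      map_zero' := tmul_zero m
      map_add' := tmul_add m }
  map_zero' := by ext v; exact zero_tmul v
  map_add' m n := by ext v; exact add_tmul m n v

@[simp]
theorem mk_apply (m : M) (v : V) : mk (B := B) m v = tmul B m v := rfl

end BalancedTensor

/-- A module is flat if and only if its character module is injective. -/
theorem isFlatModule_iff {A V : Type u} [Ring A] [AddCommGroup V] [Module A V] :
    IsFlatModule A V ↔ Module.Injective Aᵐᵒᵖ (DualModule (RingEquiv.refl Aᵐᵒᵖ) V) := by
  constructor
  · intro h
    refine ⟨fun K L _ _ _ _ f hf g ↦ ?_⟩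
    -- Uncurried, `g` is a character of K ⊗ V; flatness embeds K ⊗ V in L ⊗ V, so it extends.
    obtain ⟨ψ, hψ⟩ := DualModule.exists_character_extension _ (h f hf)
      (BalancedTensor.lift (B := A) (M := K) (V := V)
        { toFun k := (g k : V →+ AddCircle (1 : ℚ))
          map_zero' := g.map_zero
          map_add' := g.map_add } (fun k b v ↦ by
            change g (op b • k) v = g k (b • v)
            rw [g.map_smul]
            rfl))
    refine ⟨{ toFun l := DualModule.ofHom _ (ψ.comp (BalancedTensor.mk l))
              map_add' l m := by
                ext v
                simp
              map_smul' b l := by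
                ext v
                exact congrArg ψ (BalancedTensor.smul_tmul A l b.unop v) }, fun k ↦ ?_⟩
    ext v
    exact DFunLike.congr_fun hψ (BalancedTensor.tmul A k v)
  · intro h K L _ _ _ _ f hf
    rw [injective_iff_map_eq_zero]
    intro t ht
    by_contra hn
    -- A character with `χ t ≠ 0`, curried and extended to `L`, factors through `f ⊗ id`, which
    -- kills `t`.
    obtain ⟨χ, hχ⟩ := DualModule.exists_character_ne_zero hn
    obtain ⟨g, hg⟩ := h.out f hf
      { toFun k := DualModule.ofHom _ (χ.comp (BalancedTensor.mk k))
        map_add' l m := by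
          ext v
          simp
        map_smul' b l := by
          ext v
          exact congrArg χ (BalancedTensor.smul_tmul A l b.unop v) }
    let ψ : BalancedTensor A L V →+ AddCircle (1 : ℚ) := BalancedTensor.lift
        { toFun k := (g k : V →+ AddCircle (1 : ℚ))
          map_zero' := g.map_zero
          map_add' := g.map_add } (fun k b v ↦ by
            change g (op b • k) v = g k (b • v)
            rw [g.map_smul]
            rfl)
    have hψ : ψ.comp (BalancedTensor.map f LinearMap.id) = χ :=
      BalancedTensor.hom_ext fun k v ↦ DFunLike.congr_fun (hg k) v
    exact hχ (by rw [← hψ, AddMonoidHom.comp_apply, ht, map_zero])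

theorem IsFlatModule.of_projective {A V : Type u} [Ring A] [AddCommGroup V] [Module A V]
    [Module.Projective A V] : IsFlatModule A V :=
  isFlatModule_iff.2 (DualModule.injective_of_projective _)

/-! ## Injectivity of double character modules over noetherian rings -/

/-- An injective module over any ring solves every compatible finite system of equations
`a j • w = v j`. -/
theorem Module.Injective.exists_smul_eq {S W : Type u} [Ring S] [AddCommGroup W] [Module S W]
    [Module.Injective S W] {k : ℕ} (a : Fin k → S) (v : Fin k → W)
    (h : ∀ c : Fin k → S, ∑ j, c j * a j = 0 → ∑ j, c j • v j = 0) :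
    ∃ w : W, ∀ j, a j • w = v j := by
  let α : (Fin k → S) →ₗ[S] S := Fintype.linearCombination S a
  let β : (Fin k → S) →ₗ[S] W := Fintype.linearCombination S v
  have hαβ : LinearMap.ker α ≤ LinearMap.ker β := fun c hc ↦ by
    simpa [β, Fintype.linearCombination_apply] using
      h c (by simpa [α, Fintype.linearCombination_apply] using hc)
  -- `g` extends to `S` the map `∑ c j * a j ↦ ∑ c j • v j` on the left ideal generated by the `a
  -- j`; its value at `1` is the solution.
  obtain ⟨g, hg⟩ := Module.Injective.out ((LinearMap.ker α).liftQ α le_rfl)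
    (LinearMap.ker_eq_bot.1 (Submodule.ker_liftQ_eq_bot _ _ _ le_rfl))
    ((LinearMap.ker α).liftQ β hαβ)
  refine ⟨g 1, fun j ↦ ?_⟩
  have := hg (Submodule.Quotient.mk (Pi.single j 1))
  rw [Submodule.liftQ_apply, Submodule.liftQ_apply] at this
  simp only [α, β, Fintype.linearCombination_apply_single, one_smul] at this
  rw [← this, ← map_smul, smul_eq_mul, mul_one]

/-- Over a left noetherian ring, a module is injective as soon as it solves all compatible finite
systems of equations `a j • w = g (a j)`. -/
theorem Module.Injective.of_exists_smul_eq {S W : Type u} [Ring S] [IsNoetherianRing S]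
    [AddCommGroup W] [Module S W]
    (h : ∀ (k : ℕ) (a : Fin k → S) (v : Fin k → W),
      (∀ c : Fin k → S, ∑ j, c j * a j = 0 → ∑ j, c j • v j = 0) → ∃ w : W, ∀ j, a j • w = v j) :
    Module.Injective S W := by
  refine Module.Baer.injective fun I g ↦ ?_
  obtain ⟨k, a, ha⟩ := Submodule.fg_iff_exists_fin_generating_family.1 (IsNoetherian.noetherian I)
  have haI (j) : a j ∈ I := ha ▸ Submodule.subset_span ⟨j, rfl⟩
  obtain ⟨w, hw⟩ := h k a (fun j ↦ g ⟨a j, haI j⟩) (fun c hc ↦ by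
    simp_rw [← map_smul]
    rw [← map_sum]
    convert g.map_zero
    ext
    simpa using hc)
  refine ⟨LinearMap.toSpanSingleton S W w, fun x hx ↦ ?_⟩
  have hx' : x ∈ Submodule.span S (Set.range a) := ha ▸ hx
  rw [Submodule.mem_span_range_iff_exists_fun] at hx'
  obtain ⟨c, rfl⟩ := hx'
  rw [LinearMap.toSpanSingleton_apply, Finset.sum_smul]
  simp_rw [smul_assoc, hw, ← map_smul]
  rw [← map_sum]
  congr 1
  ext
  simp

namespace DualModule

variable {S T : Type u} [Ring S] [Ring T] {e : T ≃+* Sᵐᵒᵖ} {e' : S ≃+* Tᵐᵒᵖ}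
variable {W : Type u} [AddCommGroup W] [Module S W]

theorem smul_apply_smul (he : ∀ s, e (e' s).unop = op s) (s : S)
    (ξ : DualModule e' (DualModule e W)) (χ : DualModule e W) :
    (s • ξ) χ = ξ (ofHom e ((χ : W →+ AddCircle (1 : ℚ)).comp (DistribSMul.toAddMonoidHom W s))) := by
  rw [smul_apply]
  congr 1
  ext w
  rw [smul_apply, he]
  rfl

/-- The character of `Wᵏ` with the given components. -/
def sumHom {k : ℕ} (χ : Fin k → DualModule e W) : (Fin k → W) →+ AddCircle (1 : ℚ) where
  toFun v := ∑ j, χ j (v j)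
  map_zero' := by simp
  map_add' v w := by simp [Finset.sum_add_distrib]

theorem exists_sumHom {k : ℕ} (χ : (Fin k → W) →+ AddCircle (1 : ℚ)) :
    ∃ φ : Fin k → DualModule e W, ∀ v, χ v = ∑ j, φ j (v j) := by
  refine ⟨fun j ↦ ofHom e (χ.comp (AddMonoidHom.single (fun _ ↦ W) j)), fun v ↦ ?_⟩
  conv_lhs => rw [← Finset.univ_sum_single v]
  rw [map_sum]
  rfl

/-- The embedding of `W` in its double dual reflects solvability of finite systems. If `v` is not of
the form `(a j • w)`, some character `χ` of Wᵏ kills all such vectors but not `v`; a solution `ξ` in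
the double dual gives `χ v = ξ (χ ∘ α) = 0`. -/
theorem injective_of_double_dual [IsNoetherianRing S] (he : ∀ s, e (e' s).unop = op s)
    (h : Module.Injective S (DualModule e' (DualModule e W))) : Module.Injective S W := by
  refine Module.Injective.of_exists_smul_eq fun k a v hv ↦ ?_
  let ι : W →+ DualModule e' (DualModule e W) :=
    { toFun w := ofHom e' { toFun χ := χ w, map_zero' := rfl, map_add' _ _ := rfl }
      map_zero' := by ext; simp
      map_add' w w' := by
        ext χ
        exact map_add χ w w' }
  have hι (s : S) (w : W) : s • ι w = ι (s • w) := by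
    ext χ
    rw [smul_apply_smul he]
    rfl
  obtain ⟨ξ, hξ⟩ := Module.Injective.exists_smul_eq a (fun j ↦ ι (v j)) (fun c hc ↦ by
    simp_rw [hι]
    rw [← map_sum, hv c hc, map_zero])
  let α : W →+ (Fin k → W) := AddMonoidHom.mk' (fun w j ↦ a j • w) (fun w w' ↦ by
    ext j
    exact smul_add _ _ _)
  by_contra hn
  have hvα : v ∉ α.range := by
    rintro ⟨w, hw⟩
    exact hn ⟨w, fun j ↦ congrFun hw j⟩
  obtain ⟨χ, h0, hχ⟩ := exists_character_separating α.range hvα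
  obtain ⟨φ, hφ⟩ := exists_sumHom (e := e) χ
  apply hχ
  rw [hφ]
  have h1 (j) : φ j (v j) = ξ (ofHom e ((φ j : W →+ AddCircle (1 : ℚ)).comp
      (DistribSMul.toAddMonoidHom W (a j)))) := by
    rw [← smul_apply_smul he, hξ]
    rfl
  simp_rw [h1]
  rw [← map_sum]
  convert map_zero ξ
  ext w
  rw [sum_apply]
  exact (hφ (α w)).symm.trans (h0 _ ⟨w, rfl⟩)

/-- A solution of `a j • η = ξ j` is a character `η` with `η (γ χ) = Ξ χ`, so it exists once `Ξ`
kills `ker γ`. Let `r i` be finitely many generators of the relations among the `a j`. As `W` is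
injective, `ker ρ` consists of the vectors `(a j • w)`, on which `χ ∈ ker γ` vanishes; so `χ`
factors through `ρ`, and `Ξ χ = 0` follows from the compatibility of `ξ` with each `r i`. -/
theorem injective_double_dual [IsNoetherianRing S] (he : ∀ s, e (e' s).unop = op s)
    [Module.Injective S W] : Module.Injective S (DualModule e' (DualModule e W)) := by
  refine Module.Injective.of_exists_smul_eq fun k a ξ hξ ↦ ?_
  let pre (s : S) : DualModule e W →+ DualModule e W :=
    AddMonoidHom.mk' (fun χ ↦ ofHom e ((χ : W →+ AddCircle (1 : ℚ)).comp
      (DistribSMul.toAddMonoidHom W s))) (fun _ _ ↦ rfl)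
  have hpre (s : S) (χ : DualModule e W) (w : W) : pre s χ w = χ (s • w) := rfl
  let γ : (Fin k → DualModule e W) →+ DualModule e W :=
    AddMonoidHom.mk' (fun χ ↦ ∑ j, pre (a j) (χ j)) (fun χ ψ ↦ by
      simp [Finset.sum_add_distrib])
  let Ξ : (Fin k → DualModule e W) →+ AddCircle (1 : ℚ) :=
    AddMonoidHom.mk' (fun χ ↦ ∑ j, ξ j (χ j)) (fun χ ψ ↦ by simp [Finset.sum_add_distrib])
  have hker (χ) (hχ : γ χ = 0) : Ξ χ = 0 := by
    let α : (Fin k → S) →ₗ[S] S := Fintype.linearCombination S a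
    obtain ⟨m, r, hr⟩ := Submodule.fg_iff_exists_fin_generating_family.1
      (IsNoetherian.noetherian (LinearMap.ker α))
    let ρ : (Fin k → W) →+ (Fin m → W) := AddMonoidHom.mk' (fun v i ↦ ∑ j, r i j • v j)
      (fun v w ↦ by ext i; simp [Finset.sum_add_distrib])
    obtain ⟨ψ, hψ⟩ := exists_character_factor ρ (sumHom χ) (fun v hv ↦ by
      obtain ⟨w, hw⟩ := Module.Injective.exists_smul_eq a v (fun c hc ↦ by
        have hc' : c ∈ Submodule.span S (Set.range r) := by
          rw [hr, LinearMap.mem_ker]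
          simpa [α, Fintype.linearCombination_apply] using hc
        have hle : Submodule.span S (Set.range r) ≤
            LinearMap.ker (Fintype.linearCombination S v) := by
          rw [Submodule.span_le]
          rintro _ ⟨i, rfl⟩
          exact congrFun hv i
        simpa [Fintype.linearCombination_apply] using hle hc')
      change ∑ j, χ j (v j) = 0
      simp_rw [← hw]
      have := DFunLike.congr_fun hχ w
      change (∑ j, pre (a j) (χ j)) w = 0 at this
      rwa [sum_apply] at this)
    obtain ⟨φ, hφ⟩ := exists_sumHom (e := e) ψ
    have hχφ (j) : χ j = ∑ i, pre (r i j) (φ i) := by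
      ext w
      have h1 := DFunLike.congr_fun hψ (Pi.single j w)
      change ψ (ρ (Pi.single j w)) = ∑ j', χ j' ((Pi.single j w : Fin k → W) j') at h1
      rw [Finset.sum_eq_single j (fun b _ hb ↦ by simp [hb]) (by simp), Pi.single_eq_same, hφ] at h1
      rw [← h1, sum_apply]
      refine Finset.sum_congr rfl fun i _ ↦ ?_
      rw [hpre]
      congr 1
      change ∑ j', r i j' • (Pi.single j w : Fin k → W) j' = _
      rw [Finset.sum_eq_single j (fun b _ hb ↦ by simp [hb]) (by simp), Pi.single_eq_same]
    change ∑ j, ξ j (χ j) = 0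
    simp_rw [hχφ, map_sum]
    rw [Finset.sum_comm]
    refine Finset.sum_eq_zero fun i _ ↦ ?_
    have hri : r i ∈ LinearMap.ker α := hr ▸ Submodule.subset_span ⟨i, rfl⟩
    have h2 := DFunLike.congr_fun (hξ (r i)
      (by simpa [α, Fintype.linearCombination_apply] using hri)) (φ i)
    rw [sum_apply] at h2
    simp_rw [smul_apply_smul he] at h2
    exact h2
  obtain ⟨η, hη⟩ := exists_character_factor γ Ξ hker
  refine ⟨ofHom e' η, fun j ↦ ?_⟩
  ext χ
  rw [smul_apply_smul he]
  have h3 := DFunLike.congr_fun hη (Pi.single j χ)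
  change η (∑ j', pre (a j') ((Pi.single j χ : Fin k → DualModule e W) j')) =
    ∑ j', ξ j' ((Pi.single j χ : Fin k → DualModule e W) j') at h3
  rw [Finset.sum_eq_single j (fun b _ hb ↦ by simp [hb]) (by simp), Pi.single_eq_same,
    Finset.sum_eq_single j (fun b _ hb ↦ by simp [hb]) (by simp), Pi.single_eq_same] at h3
  exact h3

end DualModule

/-! ## Injective dimension and character modules -/

section

variable {S : Type u} [Ring S] {V W U : Type u} [AddCommGroup V] [Module S V]
  [AddCommGroup W] [Module S W] [AddCommGroup U] [Module S U]

/-- Shifting fails between the bounds 0 and 1, since an injective `V` does not force `U = 0`.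
Inductions on dimension therefore treat 0 and 1 separately. -/
theorem hasInjectiveDimensionLT_shift {f : V →ₗ[S] W} {g : W →ₗ[S] U}
    (hf : Function.Injective f) (hfg : Function.Exact f g) (hg : Function.Surjective g)
    [Module.Injective S W] (n : ℕ) :
    HasInjectiveDimensionLT (ModuleCat.of S U) (n + 1) ↔
      HasInjectiveDimensionLT (ModuleCat.of S V) (n + 2) :=
  (ModuleCat.shortComplex_shortExact
    (ModuleCat.shortComplexOfCompEqZero f g hfg.linearMap_comp_eq_zero)
    hfg hf hg).hasInjectiveDimensionLT_X₃_iff n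
    (Module.injective_object_of_injective_module S W)

theorem hasInjectiveDimensionLT_one_iff :
    HasInjectiveDimensionLT (ModuleCat.of S V) 1 ↔ Module.Injective S V := by
  rw [← injective_iff_hasInjectiveDimensionLT_one, Module.injective_iff_injective_object]

theorem hasInjectiveDimensionLT_zero_iff :
    HasInjectiveDimensionLT (ModuleCat.of S V) 0 ↔ Subsingleton V := by
  rw [hasInjectiveDimensionLT_zero_iff_isZero, ModuleCat.isZero_iff_subsingleton]

theorem hasInjectiveDimensionLT_of_retract (i : V →ₗ[S] W) (p : W →ₗ[S] V)
    (h : p ∘ₗ i = LinearMap.id) {n : ℕ} (hW : HasInjectiveDimensionLT (ModuleCat.of S W) n) :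
    HasInjectiveDimensionLT (ModuleCat.of S V) n :=
  Retract.hasInjectiveDimensionLT (Y := ModuleCat.of S W)
    { i := ModuleCat.ofHom i
      r := ModuleCat.ofHom p
      retract := ModuleCat.hom_ext h } n

variable (S V) in
/-- Every module embeds into an injective module. -/
theorem exists_injective_embedding : ∃ (J : ModuleCat.{u} S) (f : V →ₗ[S] J),
    Module.Injective S J ∧ Function.Injective f := by
  obtain ⟨J, _, f, _⟩ := EnoughInjectives.presentation (ModuleCat.of S V)
  exact ⟨J, f.hom, Module.injective_module_of_injective_object S J,
    (ModuleCat.mono_iff_injective f).1 ‹_›⟩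

theorem hasInjectiveDimensionLT_double_dual_iff [IsNoetherianRing S] {T : Type u} [Ring T]
    {e : T ≃+* Sᵐᵒᵖ} {e' : S ≃+* Tᵐᵒᵖ} (he : ∀ s, e (e' s).unop = op s) (n : ℕ) :
    HasInjectiveDimensionLT (ModuleCat.of S (DualModule e' (DualModule e V))) n ↔
      HasInjectiveDimensionLT (ModuleCat.of S V) n := by
  induction n generalizing V with
  | zero => rw [hasInjectiveDimensionLT_zero_iff, hasInjectiveDimensionLT_zero_iff,
      DualModule.subsingleton_iff, DualModule.subsingleton_iff]
  | succ n ih =>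
    obtain _ | n := n
    · rw [hasInjectiveDimensionLT_one_iff, hasInjectiveDimensionLT_one_iff]
      exact ⟨DualModule.injective_of_double_dual he, fun _ ↦ DualModule.injective_double_dual he⟩
    obtain ⟨J, f, hJ, hf⟩ := exists_injective_embedding S V
    have hex := f.exact_map_mkQ_range
    have hs := Submodule.mkQ_surjective f.range
    have := DualModule.injective_double_dual (W := J) he
    rw [← hasInjectiveDimensionLT_shift hf hex hs, ← hasInjectiveDimensionLT_shift
      (DualModule.map_injective e' (DualModule.map_surjective e hf))
      ((DualModule.map_exact_iff e' _ _).2 ((DualModule.map_exact_iff e _ _).2 hex))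
      (DualModule.map_surjective e' (DualModule.map_injective e hs)),
      ih]

end

/-! ## Flat dimension -/

/-- `fd V < n`, in terms of the injective dimension of the character module. -/
def HasFlatDimensionLT (A V : Type u) [Ring A] [AddCommGroup V] [Module A V] (n : ℕ) : Prop :=
  HasInjectiveDimensionLT (ModuleCat.of Aᵐᵒᵖ (DualModule (RingEquiv.refl Aᵐᵒᵖ) V)) n

section

variable {A : Type u} [Ring A] {V W U : Type u} [AddCommGroup V] [Module A V]
  [AddCommGroup W] [Module A W] [AddCommGroup U] [Module A U]

theorem hasFlatDimensionLT_zero_iff : HasFlatDimensionLT A V 0 ↔ Subsingleton V := by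
  rw [HasFlatDimensionLT, hasInjectiveDimensionLT_zero_iff, DualModule.subsingleton_iff]

theorem hasFlatDimensionLT_one_iff : HasFlatDimensionLT A V 1 ↔ IsFlatModule A V := by
  rw [HasFlatDimensionLT, hasInjectiveDimensionLT_one_iff, isFlatModule_iff]

theorem hasFlatDimensionLT_shift {f : V →ₗ[A] W} {g : W →ₗ[A] U}
    (hf : Function.Injective f) (hfg : Function.Exact f g) (hg : Function.Surjective g)
    (hW : IsFlatModule A W) (n : ℕ) :
    HasFlatDimensionLT A V (n + 1) ↔ HasFlatDimensionLT A U (n + 2) :=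
  have := isFlatModule_iff.1 hW
  hasInjectiveDimensionLT_shift (DualModule.map_injective _ hg)
    ((DualModule.map_exact_iff _ _ _).2 hfg) (DualModule.map_surjective _ hf) n

theorem HasFlatDimensionLT.of_retract (i : V →ₗ[A] W) (p : W →ₗ[A] V)
    (h : p ∘ₗ i = LinearMap.id) {n : ℕ} (hW : HasFlatDimensionLT A W n) :
    HasFlatDimensionLT A V n :=
  hasInjectiveDimensionLT_of_retract (DualModule.map _ p) (DualModule.map _ i)
    (by rw [← DualModule.map_comp, h, DualModule.map_id]) hW

theorem IsFlatModule.of_retract (i : V →ₗ[A] W) (p : W →ₗ[A] V) (h : p ∘ₗ i = LinearMap.id)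
    (hW : IsFlatModule A W) : IsFlatModule A V :=
  hasFlatDimensionLT_one_iff.1 ((hasFlatDimensionLT_one_iff.2 hW).of_retract i p h)

theorem IsFlatModule.pi (hV : IsFlatModule A V) (n : ℕ) : IsFlatModule A (Fin n → V) := by
  have := isFlatModule_iff.1 hV
  rw [← hasFlatDimensionLT_one_iff]
  let E := DualModule.piEquiv (RingEquiv.refl Aᵐᵒᵖ) (S := A) (V := V) n
  exact hasInjectiveDimensionLT_of_retract E.toLinearMap E.symm.toLinearMap (by ext1; simp)
    (hasInjectiveDimensionLT_one_iff.2 inferInstance)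

variable (A V) in
/-- Every module is a quotient of a projective module. -/
theorem exists_projective_surjection : ∃ (P : ModuleCat.{u} A) (f : P →ₗ[A] V),
    Module.Projective A P ∧ Function.Surjective f :=
  ⟨ModuleCat.of A (V →₀ A), Finsupp.linearCombination A id, inferInstance,
    Finsupp.linearCombination_id_surjective A V⟩

theorem hasFlatDimensionLE_zero_iff : HasFlatDimensionLE A V 0 ↔ IsFlatModule A V := by
  constructor
  · rintro ⟨F, d, ε, hF, hs, hε, h0, -⟩
    have hinj : Function.Injective ε := by
      rw [injective_iff_map_eq_zero]
      intro x hx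
      obtain ⟨y, rfl⟩ := (h0 x).1 hx
      have := hs 1 one_pos
      rw [Subsingleton.elim y 0, map_zero]
    let E := LinearEquiv.ofBijective ε ⟨hinj, hε⟩
    exact (hF 0).of_retract E.symm.toLinearMap E.toLinearMap (by ext; simp)
  · intro h
    refine ⟨fun i ↦ Nat.casesOn i (ModuleCat.of A V) fun _ ↦ ModuleCat.of A PUnit, fun _ ↦ 0,
      LinearMap.id, ?_, ?_, Function.surjective_id, ?_, ?_⟩
    · rintro (_ | i)
      · exact h
      · exact IsFlatModule.of_projective (V := PUnit.{u + 1})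
    · rintro (_ | i) hi
      · exact absurd hi (lt_irrefl 0)
      · exact inferInstanceAs (Subsingleton PUnit)
    · exact fun x ↦ ⟨fun hx ↦ ⟨0, hx.symm⟩, by rintro ⟨y, rfl⟩; rfl⟩
    · exact fun i x ↦ ⟨fun _ ↦ ⟨0, Subsingleton.elim (α := PUnit.{u + 1}) _ _⟩, fun _ ↦ rfl⟩

theorem HasFlatDimensionLE.exists_syzygy {n : ℕ} (h : HasFlatDimensionLE A V (n + 1)) :
    ∃ (P : ModuleCat.{u} A) (ε : P →ₗ[A] V), IsFlatModule A P ∧ Function.Surjective ε ∧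
      HasFlatDimensionLE A (LinearMap.ker ε) n := by
  obtain ⟨F, d, ε, hF, hs, hε, h0, h1⟩ := h
  refine ⟨F 0, ε, hF 0, hε, fun i ↦ F (i + 1), fun i ↦ d (i + 1),
    (d 0).codRestrict _ fun x ↦ (h0 _).2 ⟨x, rfl⟩, fun i ↦ hF _,
    fun i hi ↦ hs _ (Nat.succ_lt_succ hi), ?_, ?_, fun i ↦ h1 _⟩
  · rintro ⟨x, hx⟩
    obtain ⟨y, rfl⟩ := (h0 x).1 hx
    exact ⟨y, rfl⟩
  · intro x
    rw [← h1 0 x, Subtype.ext_iff]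
    rfl

/-- Prepend a module to a sequence of modules. -/
def consModule (P : ModuleCat.{u} A) (F : ℕ → ModuleCat.{u} A) : ℕ → ModuleCat.{u} A
  | 0 => P
  | i + 1 => F i

/-- Prepend a linear map to a sequence of linear maps. -/
def consMap (P : ModuleCat.{u} A) {F : ℕ → ModuleCat.{u} A} (f : F 0 →ₗ[A] P)
    (d : ∀ i, F (i + 1) →ₗ[A] F i) : ∀ i, consModule P F (i + 1) →ₗ[A] consModule P F i
  | 0 => f
  | i + 1 => d i

theorem HasFlatDimensionLE.of_exact {f : V →ₗ[A] W} {g : W →ₗ[A] U}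
    (hf : Function.Injective f) (hfg : Function.Exact f g) (hg : Function.Surjective g)
    (hW : IsFlatModule A W) {n : ℕ} (h : HasFlatDimensionLE A V n) :
    HasFlatDimensionLE A U (n + 1) := by
  obtain ⟨F, d, ε, hF, hs, hε, h0, h1⟩ := h
  refine ⟨consModule (ModuleCat.of A W) F, consMap (ModuleCat.of A W) (f ∘ₗ ε) d, g, ?_, ?_, hg, ?_, ?_⟩
  · rintro (_ | i)
    · exact hW
    · exact hF i
  · rintro (_ | i) hi
    · exact absurd hi (Nat.not_lt_zero _)
    · exact hs i (Nat.lt_of_succ_lt_succ hi)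
  · refine fun x ↦ (hfg x).trans ⟨?_, ?_⟩
    · rintro ⟨v, rfl⟩
      obtain ⟨y, rfl⟩ := hε v
      exact ⟨y, rfl⟩
    · rintro ⟨y, rfl⟩
      exact ⟨ε y, rfl⟩
  · rintro (_ | i)
    · exact fun x ↦ (map_eq_zero_iff f hf).trans (h0 x)
    · exact h1 i

/-- Both sides shift along syzygies. A flat resolution supplies a particular syzygy, whereas the
character description can be tested on any flat presentation and visibly passes to summands. -/
theorem hasFlatDimensionLE_iff (n : ℕ) : HasFlatDimensionLE A V n ↔
    HasFlatDimensionLT A V (n + 1) := by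
  induction n generalizing V with
  | zero => rw [hasFlatDimensionLE_zero_iff, hasFlatDimensionLT_one_iff]
  | succ n ih =>
    constructor
    · intro h
      obtain ⟨P, ε, hP, hε, hK⟩ := h.exists_syzygy
      exact (hasFlatDimensionLT_shift (LinearMap.ker ε).injective_subtype
        (LinearMap.exact_subtype_ker_map ε) hε hP n).1 (ih.1 hK)
    · intro h
      obtain ⟨P, ε, _, hε⟩ := exists_projective_surjection A V
      exact HasFlatDimensionLE.of_exact (LinearMap.ker ε).injective_subtype
        (LinearMap.exact_subtype_ker_map ε) hε .of_projective
        (ih.2 ((hasFlatDimensionLT_shift (LinearMap.ker ε).injective_subtype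
          (LinearMap.exact_subtype_ker_map ε) hε .of_projective n).2 h))

end

/-! ## Exact functors preserving injective, projective and flat modules -/

/-- A functor between module categories which is exact and preserves injective, projective and
flat modules. -/
structure IsHomologicalTransfer {A B : Type u} [Ring A] [Ring B]
    (H : ModuleCat.{u} B ⥤ ModuleCat.{u} A) : Prop where
  exact : ∀ {X Y Z : ModuleCat.{u} B} (f : X ⟶ Y) (g : Y ⟶ Z), Function.Exact f.hom g.hom →
    Function.Exact (H.map f).hom (H.map g).hom
  injective : ∀ X : ModuleCat.{u} B, Module.Injective B X → Module.Injective A (H.obj X)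
  projective : ∀ X : ModuleCat.{u} B, Module.Projective B X → Module.Projective A (H.obj X)
  flat : ∀ X : ModuleCat.{u} B, IsFlatModule B X → IsFlatModule A (H.obj X)

namespace IsHomologicalTransfer

variable {A B C : Type u} [Ring A] [Ring B] [Ring C] {H : ModuleCat.{u} B ⥤ ModuleCat.{u} A}

theorem comp (hH : IsHomologicalTransfer H) {H' : ModuleCat.{u} C ⥤ ModuleCat.{u} B}
    (hH' : IsHomologicalTransfer H') : IsHomologicalTransfer (H' ⋙ H) where
  exact f g h := hH.exact _ _ (hH'.exact f g h)
  injective X h := hH.injective _ (hH'.injective X h)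
  projective X h := hH.projective _ (hH'.projective X h)
  flat X h := hH.flat _ (hH'.flat X h)

/-- Additivity of `H` is not needed: a module is zero exactly when the pair `𝟙`, `𝟙` is exact, and
`H` preserves this. -/
theorem subsingleton (hH : IsHomologicalTransfer H) (X : ModuleCat.{u} B) [Subsingleton X] :
    Subsingleton (H.obj X) := by
  have h := hH.exact (𝟙 X) (𝟙 X)
    (fun x ↦ ⟨fun _ ↦ ⟨x, rfl⟩, fun _ ↦ Subsingleton.elim (α := X) _ _⟩)
  rw [H.map_id] at h
  exact subsingleton_of_forall_eq 0 fun x ↦ (h x).2 ⟨x, rfl⟩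

theorem map_injective (hH : IsHomologicalTransfer H) {X Y : ModuleCat.{u} B} (f : X ⟶ Y)
    (hf : Function.Injective f.hom) : Function.Injective (H.map f).hom := by
  have h := hH.exact (0 : ModuleCat.of B PUnit ⟶ X) f fun x ↦ by
    rw [map_eq_zero_iff _ hf]
    exact ⟨fun hx ↦ ⟨0, hx.symm⟩, by rintro ⟨y, rfl⟩; rfl⟩
  have := hH.subsingleton (ModuleCat.of B PUnit)
  rw [injective_iff_map_eq_zero]
  intro x hx
  obtain ⟨y, rfl⟩ := (h x).1 hx
  rw [Subsingleton.elim y 0, map_zero]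

theorem map_surjective (hH : IsHomologicalTransfer H) {X Y : ModuleCat.{u} B} (f : X ⟶ Y)
    (hf : Function.Surjective f.hom) : Function.Surjective (H.map f).hom := by
  have h := hH.exact f (0 : Y ⟶ ModuleCat.of B PUnit) fun y ↦ ⟨fun _ ↦ hf y, fun _ ↦ rfl⟩
  have := hH.subsingleton (ModuleCat.of B PUnit)
  exact fun y ↦ (h y).1 (Subsingleton.elim _ _)

theorem hasInjectiveDimensionLT (hH : IsHomologicalTransfer H) {X : ModuleCat.{u} B} {n : ℕ}
    (hX : HasInjectiveDimensionLT X n) : HasInjectiveDimensionLT (H.obj X) n := by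
  induction n generalizing X with
  | zero =>
    have := hasInjectiveDimensionLT_zero_iff.1 hX
    exact hasInjectiveDimensionLT_zero_iff.2 (hH.subsingleton X)
  | succ n ih =>
    obtain _ | n := n
    · exact hasInjectiveDimensionLT_one_iff.2
        (hH.injective _ (hasInjectiveDimensionLT_one_iff.1 hX))
    · obtain ⟨J, f, hJ, hf⟩ := exists_injective_embedding B X
      have hex := f.exact_map_mkQ_range
      have hs := Submodule.mkQ_surjective f.range
      have := hH.injective J hJ
      have hX' := (hasInjectiveDimensionLT_shift hf hex hs n).2 hX
      exact (hasInjectiveDimensionLT_shift (hH.map_injective (ModuleCat.ofHom f) hf)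
        (hH.exact (ModuleCat.ofHom f) (ModuleCat.ofHom f.range.mkQ) hex)
        (hH.map_surjective (ModuleCat.ofHom f.range.mkQ) hs) n).1 (ih hX')

theorem hasFlatDimensionLT (hH : IsHomologicalTransfer H) {X : ModuleCat.{u} B} {n : ℕ}
    (hX : HasFlatDimensionLT B X n) : HasFlatDimensionLT A (H.obj X) n := by
  induction n generalizing X with
  | zero =>
    have := hasFlatDimensionLT_zero_iff.1 hX
    exact hasFlatDimensionLT_zero_iff.2 (hH.subsingleton X)
  | succ n ih =>
    obtain _ | n := n
    · exact hasFlatDimensionLT_one_iff.2 (hH.flat _ (hasFlatDimensionLT_one_iff.1 hX))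
    · obtain ⟨P, f, hP, hf⟩ := exists_projective_surjection B X
      have hi := (LinearMap.ker f).injective_subtype
      have hex := LinearMap.exact_subtype_ker_map f
      have hX' := (hasFlatDimensionLT_shift hi hex hf .of_projective n).2 hX
      exact (hasFlatDimensionLT_shift
        (hH.map_injective (ModuleCat.ofHom (LinearMap.ker f).subtype) hi)
        (hH.exact (ModuleCat.ofHom (LinearMap.ker f).subtype) (ModuleCat.ofHom f) hex)
        (hH.map_surjective (ModuleCat.ofHom f) hf) (hH.flat P .of_projective) n).1
        (ih (X := ModuleCat.of B (LinearMap.ker f)) hX')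

end IsHomologicalTransfer

/-! ### Finite powers -/

/-- The functor `V ↦ Vⁿ`. -/
def powerFunctor (A : Type u) [Ring A] (n : ℕ) : ModuleCat.{u} A ⥤ ModuleCat.{u} A where
  obj V := ModuleCat.of A (Fin n → V)
  map f := ModuleCat.ofHom (f.hom.compLeft (Fin n))

theorem powerFunctor_isHomologicalTransfer (A : Type u) [Ring A] (n : ℕ) :
    IsHomologicalTransfer (powerFunctor A n) where
  exact f g h x := by
    constructor
    · intro hx
      choose y hy using fun i ↦ (h (x i)).1 (congrFun hx i)
      exact ⟨y, funext hy⟩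
    · rintro ⟨y, rfl⟩
      exact funext fun i ↦ h.apply_apply_eq_zero (y i)
  injective X h := inferInstanceAs (Module.Injective A (Fin n → X))
  projective X h := Module.Projective.of_equiv
    (DirectSum.linearEquivFunOnFintype A (Fin n) (fun _ ↦ X))
  flat X h := h.pi n

/-! ### Tensor functors -/

namespace Bimodule

variable {A B : Type u} [Ring A] [Ring B]

/-- A map K → D(M ⊗ V) is the same as a right `B`-linear map K ⊗ M → D(V). It extends to L ⊗ M
because `M` is flat over `A` and D(V) is injective. This bypasses associativity of the tensor
product. -/
theorem isFlatModule_balancedTensor (M : Bimodule A B) (hM : IsFlatModule A M) {V : Type u}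
    [AddCommGroup V] [Module B V] (hV : IsFlatModule B V) :
    IsFlatModule A (BalancedTensor B M V) := by
  rw [isFlatModule_iff] at hV ⊢
  refine ⟨fun K L _ _ _ _ f hf g ↦ ?_⟩
  let : Module Bᵐᵒᵖ (BalancedTensor A K M) := BalancedTensor.rightModule K M
  let : Module Bᵐᵒᵖ (BalancedTensor A L M) := BalancedTensor.rightModule L M
  have hsmulK (b : Bᵐᵒᵖ) (k : K) (m : M) :
    b • BalancedTensor.tmul A k m = BalancedTensor.tmul A k (b • m) := rfl
  have hsmulL (b : Bᵐᵒᵖ) (l : L) (m : M) :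
    b • BalancedTensor.tmul A l m = BalancedTensor.tmul A l (b • m) := rfl
  let f' : BalancedTensor A K M →ₗ[Bᵐᵒᵖ] BalancedTensor A L M :=
    { toFun := BalancedTensor.map f LinearMap.id
      map_add' := map_add _
      map_smul' b t := by
        induction t using BalancedTensor.induction_on with
        | tmul k m => rfl
        | add x y hx hy => simp only [smul_add, map_add, hx, hy] }
  let g₀ : BalancedTensor A K M →+ DualModule (RingEquiv.refl Bᵐᵒᵖ) V := BalancedTensor.lift
    (AddMonoidHom.mk' (fun k ↦ AddMonoidHom.mk' (fun m ↦ DualModule.ofHom (RingEquiv.refl Bᵐᵒᵖ)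
        ((g k : BalancedTensor B M V →+ AddCircle (1 : ℚ)).comp (BalancedTensor.mk m)))
        (fun m m' ↦ by
          ext v
          change g k (BalancedTensor.mk (m + m') v) =
            g k (BalancedTensor.mk m v) + g k (BalancedTensor.mk m' v)
          rw [map_add, AddMonoidHom.add_apply, map_add]))
      (fun k k' ↦ by
        ext m v
        change g (k + k') _ = g k _ + g k' _
        rw [map_add]
        rfl))
    (fun k a m ↦ by
      ext v
      change g (op a • k) (BalancedTensor.tmul B m v) = g k (BalancedTensor.tmul B (a • m) v)
      rw [map_smul]
      rfl)
  have hg₀ (k : K) (m : M) (v : V) : g₀ (BalancedTensor.tmul A k m) v =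
    g k (BalancedTensor.tmul B m v) := rfl
  let g' : BalancedTensor A K M →ₗ[Bᵐᵒᵖ] DualModule (RingEquiv.refl Bᵐᵒᵖ) V :=
    { toFun := g₀
      map_add' := map_add _
      map_smul' b t := by
        induction t using BalancedTensor.induction_on with
        | tmul k m =>
          ext v
          rw [hsmulK, hg₀, RingHom.id_apply, DualModule.smul_apply, hg₀]
          exact congrArg (g k) (BalancedTensor.smul_tmul B m b.unop v)
        | add x y hx hy => simp only [smul_add, map_add, hx, hy] }
  obtain ⟨h', hh'⟩ := hV.out f' (hM f hf) g'
  let h₀ (l : L) : BalancedTensor B M V →+ AddCircle (1 : ℚ) := BalancedTensor.lift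
    (AddMonoidHom.mk' (fun m ↦ (h' (BalancedTensor.tmul A l m) : V →+ AddCircle (1 : ℚ)))
      (fun m m' ↦ by
        rw [BalancedTensor.tmul_add, map_add]
        rfl))
    (fun m b v ↦ by
      change h' (BalancedTensor.tmul A l (op b • m)) v = h' (BalancedTensor.tmul A l m) (b • v)
      rw [← hsmulL, map_smul]
      rfl)
  have hh₀ (l : L) (m : M) (v : V) : h₀ l (BalancedTensor.tmul B m v) =
    h' (BalancedTensor.tmul A l m) v := rfl
  refine ⟨{ toFun l := DualModule.ofHom _ (h₀ l)
            map_add' l l' := ?_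
            map_smul' a l := ?_ }, fun k ↦ ?_⟩
  · refine BalancedTensor.hom_ext fun m v ↦ ?_
    change h₀ (l + l') _ = h₀ l _ + h₀ l' _
    rw [hh₀, hh₀, hh₀, BalancedTensor.add_tmul, map_add]
    rfl
  · refine BalancedTensor.hom_ext fun m v ↦ ?_
    change h₀ (a • l) _ = h₀ l (BalancedTensor.tmul B (a.unop • m) v)
    rw [hh₀, hh₀, ← BalancedTensor.smul_tmul, op_unop]
  · refine BalancedTensor.hom_ext fun m v ↦ ?_
    exact DFunLike.congr_fun (hh' (BalancedTensor.tmul A k m)) v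

/-- A functor with adjoints on both sides is exact. Its left adjoint `N ⊗ -` preserves
monomorphisms, so it preserves injectives; the same functor as right adjoint preserves epimorphisms,
so it preserves projectives. -/
theorem tensorFunctor_isHomologicalTransfer (M : Bimodule A B) (N : Bimodule B A)
    (hM : M.IsFGProjectiveOneSided) (adj : M.tensorFunctor ⊣ N.tensorFunctor)
    (adj' : N.tensorFunctor ⊣ M.tensorFunctor) : IsHomologicalTransfer M.tensorFunctor := by
  have := adj.isLeftAdjoint
  have := adj'.isRightAdjoint
  have := adj.isRightAdjoint
  have := adj'.isLeftAdjoint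
  have := hM.projective_left
  refine ⟨fun {X Y Z} f g h ↦ ?_, fun X hX ↦ ?_, fun X hX ↦ ?_,
    fun _ ↦ M.isFlatModule_balancedTensor .of_projective⟩
  · let S := ModuleCat.shortComplexOfCompEqZero f.hom g.hom h.linearMap_comp_eq_zero
    have hS : S.Exact := ModuleCat.shortComplex_exact S h
    exact (ShortComplex.ShortExact.moduleCat_exact_iff_function_exact _).1
      (hS.map M.tensorFunctor)
  · have := Module.injective_object_of_injective_module B X
    have := adj'.map_injective X this
    exact Module.injective_module_of_injective_object A (M.tensorFunctor.obj X)
  · rw [IsProjective.iff_projective] at hX ⊢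
    exact adj.map_projective X hX

end Bimodule

/-! ## Transfer of the regular modules along a separable equivalence -/

/-- `V` is isomorphic to a direct summand of `W`. -/
def IsRetract (A : Type u) [Ring A] (V W : Type u) [AddCommGroup V] [Module A V]
    [AddCommGroup W] [Module A W] : Prop :=
  ∃ (i : V →ₗ[A] W) (p : W →ₗ[A] V), p ∘ₗ i = LinearMap.id

namespace IsRetract

variable {A : Type u} [Ring A] {V W U : Type u} [AddCommGroup V] [Module A V]
  [AddCommGroup W] [Module A W] [AddCommGroup U] [Module A U]

theorem trans (h : IsRetract A V W) (h' : IsRetract A W U) : IsRetract A V U := by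
  obtain ⟨i, p, hp⟩ := h
  obtain ⟨i', p', hp'⟩ := h'
  refine ⟨i' ∘ₗ i, p ∘ₗ p', ?_⟩
  rw [LinearMap.comp_assoc, ← LinearMap.comp_assoc i i' p', hp', LinearMap.id_comp, hp]

theorem of_equiv (e : V ≃ₗ[A] W) : IsRetract A V W :=
  ⟨e.toLinearMap, e.symm.toLinearMap, by ext; simp⟩

theorem dual {T : Type u} [Ring T] (e : T ≃+* Aᵐᵒᵖ) (h : IsRetract A V W) :
    IsRetract T (DualModule e V) (DualModule e W) := by
  obtain ⟨i, p, hp⟩ := h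
  exact ⟨DualModule.map e p, DualModule.map e i, by
    rw [← DualModule.map_comp, hp, DualModule.map_id]⟩

theorem map_functor {B : Type u} [Ring B] (H : ModuleCat.{u} A ⥤ ModuleCat.{u} B)
    (h : IsRetract A V W) :
    IsRetract B (H.obj (ModuleCat.of A V)) (H.obj (ModuleCat.of A W)) := by
  obtain ⟨i, p, hp⟩ := h
  refine ⟨(H.map (ModuleCat.ofHom i)).hom, (H.map (ModuleCat.ofHom p)).hom, ?_⟩
  rw [← ModuleCat.hom_comp, ← H.map_comp, ← ModuleCat.ofHom_comp, hp, ModuleCat.ofHom_id,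
    H.map_id, ModuleCat.hom_id]

theorem injective (h : IsRetract A V W) (hW : Module.Injective A W) : Module.Injective A V := by
  obtain ⟨i, p, hp⟩ := h
  exact hasInjectiveDimensionLT_one_iff.1
    (hasInjectiveDimensionLT_of_retract i p hp (hasInjectiveDimensionLT_one_iff.2 hW))

theorem projective (h : IsRetract A V W) (hW : Module.Projective A W) :
    Module.Projective A V := by
  obtain ⟨i, p, hp⟩ := h
  exact Module.Projective.of_split i p hp

theorem hasInjectiveDimensionLT (h : IsRetract A V W) {n : ℕ}
    (hW : HasInjectiveDimensionLT (ModuleCat.of A W) n) :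
    HasInjectiveDimensionLT (ModuleCat.of A V) n := by
  obtain ⟨i, p, hp⟩ := h
  exact hasInjectiveDimensionLT_of_retract i p hp hW

theorem hasFlatDimensionLT (h : IsRetract A V W) {n : ℕ} (hW : HasFlatDimensionLT A W n) :
    HasFlatDimensionLT A V n := by
  obtain ⟨i, p, hp⟩ := h
  exact hW.of_retract i p hp

end IsRetract

theorem exists_isRetract_power (A P : Type u) [Ring A] [AddCommGroup P] [Module A P]
    [Module.Finite A P] [Module.Projective A P] : ∃ n, IsRetract A P (Fin n → A) := by
  obtain ⟨n, p, hp⟩ := Module.Finite.exists_fin' A P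
  obtain ⟨i, hi⟩ := Module.projective_lifting_property p LinearMap.id hp
  exact ⟨n, i, p, hi⟩

namespace Bimodule

variable {A B : Type u} [Ring A] [Ring B]

/-- The character module of a right module, as a left module. -/
abbrev RightDual (A V : Type u) [Ring A] [AddCommGroup V] [Module Aᵐᵒᵖ V] : Type u :=
  DualModule (RingEquiv.opOp A) V

/-- If `N ⊗ -` is left adjoint to `M ⊗ -`, then `Hom(M ⊗ N, ℚ/ℤ)` is a direct summand of
`M ⊗ Hom(M, ℚ/ℤ)`. -/
theorem isRetract_rightDual_tensor (M : Bimodule A B) (N : Bimodule B A)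
    (adj : N.tensorFunctor ⊣ M.tensorFunctor) :
    IsRetract A (RightDual A (M.tensor N))
      (M.tensorFunctor.obj (ModuleCat.of B (RightDual B M))) := by
  let D := ModuleCat.of B (RightDual B M)
  let R := ModuleCat.of A A
  let pairing (χ : RightDual A (M.tensor N)) (m : M) (n : N) : AddCircle (1 : ℚ) :=
    χ (BalancedTensor.tmul B m n)
  have pairing_add (χ : RightDual A (M.tensor N)) (m : M) (n n' : N) :
      pairing χ m (n + n') = pairing χ m n + pairing χ m n' :=
    (congrArg χ (BalancedTensor.tmul_add m n n')).trans (map_add χ _ _)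
  have pairing_add_left (χ : RightDual A (M.tensor N)) (m m' : M) (n : N) :
      pairing χ (m + m') n = pairing χ m n + pairing χ m' n :=
    (congrArg χ (BalancedTensor.add_tmul m m' n)).trans (map_add χ _ _)
  have pairing_balanced (χ : RightDual A (M.tensor N)) (m : M) (b : B) (n : N) :
      pairing χ (op b • m) n = pairing χ m (b • n) :=
    congrArg χ (BalancedTensor.smul_tmul B m b n)
  let toDual (χ : RightDual A (M.tensor N)) (n : N) : RightDual B M :=
    DualModule.ofHom _ (AddMonoidHom.mk' (fun m ↦ pairing χ m n)
      (fun m m' ↦ pairing_add_left χ m m' n))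
  let ψ₀ (χ : RightDual A (M.tensor N)) : BalancedTensor A N A →+ RightDual B M :=
    BalancedTensor.lift
      (AddMonoidHom.mk' (fun n ↦ AddMonoidHom.mk' (fun a ↦ toDual χ (op a • n))
        (fun a a' ↦ by
          ext m
          rw [MulOpposite.op_add, add_smul, DualModule.add_apply]
          exact pairing_add χ _ _ _))
        (fun n n' ↦ by
          ext a m
          change pairing χ m (op a • (n + n')) = pairing χ m (op a • n) + pairing χ m (op a • n')
          rw [smul_add, pairing_add]))
      (fun n a a' ↦ by
        change toDual χ (op a' • op a • n) = toDual χ (op (a * a') • n)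
        rw [MulOpposite.op_mul, mul_smul])
  -- `ψ χ` sends n ⊗ a to the character m ↦ χ(m ⊗ na).
  let ψ (χ : RightDual A (M.tensor N)) : N.tensorFunctor.obj R ⟶ D := ModuleCat.ofHom
    { toFun := ψ₀ χ
      map_add' := map_add _
      map_smul' b (t : BalancedTensor A N A) := by
        induction t using BalancedTensor.induction_on with
        | tmul n a =>
          ext m
          change pairing χ m (op a • b • n) = pairing χ (op b • m) (op a • n)
          rw [pairing_balanced, smul_comm b (op a) n]
        | add x y hx hy => rw [smul_add, map_add, hx, hy, map_add, smul_add] }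
  let η₁ : M.tensorFunctor.obj (N.tensorFunctor.obj R) := (adj.unit.app R).hom (1 : A)
  have hψ_add (χ χ' : RightDual A (M.tensor N)) : ψ (χ + χ') = ψ χ + ψ χ' := by
    refine ModuleCat.hom_ext (LinearMap.toAddMonoidHom_injective ?_)
    exact BalancedTensor.hom_ext fun n a ↦ rfl
  have hmap_add (f g : N.tensorFunctor.obj R ⟶ D) (t : M.tensorFunctor.obj (N.tensorFunctor.obj R)) :
      (M.tensorFunctor.map (f + g)).hom t =
        (M.tensorFunctor.map f).hom t + (M.tensorFunctor.map g).hom t := by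
    have h : (M.tensorFunctor.map (f + g)).hom.toAddMonoidHom =
        (M.tensorFunctor.map f).hom.toAddMonoidHom + (M.tensorFunctor.map g).hom.toAddMonoidHom :=
      BalancedTensor.hom_ext fun m v ↦ BalancedTensor.tmul_add m (f.hom v) (g.hom v)
    exact DFunLike.congr_fun h t
  -- Right multiplications are left linear; naturality of the unit at `ρ a` will make `u` linear.
  let ρ (a : A) : A →ₗ[A] A :=
    { toFun x := x * a
      map_add' x y := add_mul x y a
      map_smul' b x := mul_assoc b x a }
  have hψ_smul (a : A) (χ : RightDual A (M.tensor N)) : ψ (a • χ) =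
      N.tensorFunctor.map (ModuleCat.ofHom (ρ a) : R ⟶ R) ≫ ψ χ := by
    refine ModuleCat.hom_ext (LinearMap.toAddMonoidHom_injective ?_)
    refine BalancedTensor.hom_ext fun n a' ↦ ?_
    refine DualModule.ext (e := RingEquiv.opOp B) (V := M) fun m ↦ ?_
    change pairing χ m (op a • op a' • n) = pairing χ m (op (a' * a) • n)
    rw [MulOpposite.op_mul, mul_smul]
  -- The adjunction turns `ψ χ` into a map A → M ⊗ D(M); `u χ` is its value at `1`.
  let u : RightDual A (M.tensor N) →ₗ[A] M.tensorFunctor.obj D :=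
    { toFun χ := (M.tensorFunctor.map (ψ χ)).hom η₁
      map_add' χ χ' := by rw [hψ_add, hmap_add]
      map_smul' a χ := by
        have h := congrArg (fun f ↦ f.hom (1 : A))
          (adj.unit.naturality (ModuleCat.ofHom (ρ a) : R ⟶ R))
        have h' : (adj.unit.app R).hom (1 * a : A) = (M.tensorFunctor.map (N.tensorFunctor.map
          (ModuleCat.ofHom (ρ a) : R ⟶ R))).hom η₁ := h
        rw [hψ_smul, M.tensorFunctor.map_comp, ModuleCat.hom_comp, LinearMap.comp_apply, ← h',
          one_mul, RingHom.id_apply, ← map_smul]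
        congr 1
        rw [← map_smul]
        congr 1
        exact (mul_one a).symm }
  let ε := (adj.counit.app D).hom
  let evalAt (x : M.tensorFunctor.obj D) (n : N) : RightDual B M :=
    ε (BalancedTensor.tmul A n x : BalancedTensor A N (M.tensorFunctor.obj D))
  have evalAt_add (x n n') : evalAt x (n + n') = evalAt x n + evalAt x n' :=
    (congrArg ε (BalancedTensor.add_tmul n n' x)).trans (map_add ε _ _)
  have evalAt_add_left (x x' n) : evalAt (x + x') n = evalAt x n + evalAt x' n :=
    (congrArg ε (BalancedTensor.tmul_add n x x')).trans (map_add ε _ _)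
  have evalAt_smul (b : B) (x n) : evalAt x (b • n) = b • evalAt x n :=
    ε.map_smul b (BalancedTensor.tmul A n x : BalancedTensor A N (M.tensorFunctor.obj D))
  have evalAt_balanced (a : A) (x n) : evalAt x (op a • n) = evalAt (a • x) n :=
    congrArg ε (BalancedTensor.smul_tmul A n a x)
  -- In the other direction, x gives the character m ⊗ n ↦ ε(n ⊗ x)(m), with ε the counit.
  let w₀ (x : M.tensorFunctor.obj D) : BalancedTensor B M N →+ AddCircle (1 : ℚ) :=
    BalancedTensor.lift
      (AddMonoidHom.mk' (fun m ↦ AddMonoidHom.mk' (fun n ↦ evalAt x n m)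
        (fun n n' ↦ by rw [evalAt_add, DualModule.add_apply]))
        (fun m m' ↦ by
          ext n
          exact map_add (evalAt x n) m m'))
      (fun m b n ↦ by
        change evalAt x n (op b • m) = evalAt x (b • n) m
        rw [evalAt_smul]
        rfl)
  let w : M.tensorFunctor.obj D →ₗ[A] RightDual A (M.tensor N) :=
    { toFun x := DualModule.ofHom _ (w₀ x)
      map_add' x x' := BalancedTensor.hom_ext fun m n ↦
        DFunLike.congr_fun (evalAt_add_left x x' n) m
      map_smul' a x := BalancedTensor.hom_ext fun m n ↦
        (DFunLike.congr_fun (evalAt_balanced a x n) m).symm }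
  refine ⟨u, w, LinearMap.ext fun χ ↦ ?_⟩
  refine BalancedTensor.hom_ext fun m n ↦ ?_
  let t : N.tensorFunctor.obj R := (BalancedTensor.tmul A n (1 : A) : BalancedTensor A N A)
  -- Naturality of the counit moves `ψ χ` outside, and the triangle identity leaves `ψ χ` at n ⊗ 1.
  have h1 := congrArg (fun f ↦ f.hom t) (adj.left_triangle_components R)
  have h2 := congrArg (fun f ↦ f.hom ((N.tensorFunctor.map (adj.unit.app R)).hom t))
    (adj.counit.naturality (ψ χ))
  have h3 : evalAt (u χ) n = (ψ χ).hom ((adj.counit.app (N.tensorFunctor.obj R)).hom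
    ((N.tensorFunctor.map (adj.unit.app R)).hom t)) := h2
  have h4 : (adj.counit.app (N.tensorFunctor.obj R)).hom
    ((N.tensorFunctor.map (adj.unit.app R)).hom t) = t := h1
  rw [h4] at h3
  refine (DFunLike.congr_fun h3 m).trans ?_
  change pairing χ m (op (1 : A) • n) = pairing χ m n
  rw [MulOpposite.op_one, one_smul]


theorem isRetract_regular_tensor (M : Bimodule A B) (N : Bimodule B A) {X : Bimodule A A}
    (h : (M.tensor N).Isomorphic ((regular A).directSum X)) :
    IsRetract A A (M.tensorFunctor.obj (ModuleCat.of B N)) := by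
  obtain ⟨e, -⟩ := h
  let e' : BalancedTensor B M N ≃ₗ[A] A × X := e
  refine ⟨e'.symm.toLinearMap ∘ₗ LinearMap.inl A A X, LinearMap.fst A A X ∘ₗ e'.toLinearMap, ?_⟩
  refine LinearMap.ext fun a ↦ ?_
  change (e' (e'.symm (a, 0))).1 = a
  rw [e'.apply_symm_apply]

theorem isRetract_right_regular_tensor (M : Bimodule A B) (N : Bimodule B A) {X : Bimodule A A}
    (h : (M.tensor N).Isomorphic ((regular A).directSum X)) :
    IsRetract Aᵐᵒᵖ A (M.tensor N) := by
  obtain ⟨e, he⟩ := h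
  let e' : M.tensor N ≃ₗ[Aᵐᵒᵖ] (regular A).directSum X :=
    { e with map_smul' := fun b x ↦ he b.unop x }
  refine ⟨e'.symm.toLinearMap ∘ₗ LinearMap.inl Aᵐᵒᵖ A X,
    LinearMap.fst Aᵐᵒᵖ A X ∘ₗ e'.toLinearMap, ?_⟩
  refine LinearMap.ext fun a ↦ ?_
  change (e' (e'.symm (a, 0))).1 = a
  rw [e'.apply_symm_apply]

end Bimodule

/-! ### Transfer functors, and comparison of self-injective dimensions -/

section

variable {A B : Type u} [Ring A] [Ring B] {M : Bimodule A B} {N : Bimodule B A}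

theorem IsSeparablyEquivalentBy.symm (h : IsSeparablyEquivalentBy M N) :
    IsSeparablyEquivalentBy N M :=
  ⟨h.fg_projective_snd, h.fg_projective_fst, h.exists_right, h.exists_left⟩

theorem SymmetricallySeparablyEquivalent.symm (h : SymmetricallySeparablyEquivalent A B) :
    SymmetricallySeparablyEquivalent B A := by
  obtain ⟨M, N, h, h1, h2⟩ := h
  exact ⟨N, M, h.symm, h2, h1⟩

theorem SymmetricallySeparablyEquivalent.exists_transfer
    (h : SymmetricallySeparablyEquivalent A B) :
    ∃ H : ModuleCat.{u} B ⥤ ModuleCat.{u} A, IsHomologicalTransfer H ∧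
      IsRetract A A (H.obj (ModuleCat.of B B)) := by
  obtain ⟨M, N, h, ⟨adj⟩, ⟨adj'⟩⟩ := h
  have := h.fg_projective_snd.finite_left
  have := h.fg_projective_snd.projective_left
  obtain ⟨n, hn⟩ := exists_isRetract_power B N
  obtain ⟨X, hX⟩ := h.exists_left
  exact ⟨powerFunctor B n ⋙ M.tensorFunctor,
    (M.tensorFunctor_isHomologicalTransfer N h.fg_projective_fst adj adj').comp
      (powerFunctor_isHomologicalTransfer B n),
    (M.isRetract_regular_tensor N hX).trans (hn.map_functor M.tensorFunctor)⟩

/-- The chain of summands is D(A), D(M ⊗ N), M ⊗ D(M), M ⊗ D(B)ⁿ; the last link uses that `M` is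
finitely generated projective on the right. -/
theorem SymmetricallySeparablyEquivalent.exists_transfer_rightDual
    (h : SymmetricallySeparablyEquivalent A B) :
    ∃ H : ModuleCat.{u} B ⥤ ModuleCat.{u} A, IsHomologicalTransfer H ∧
      IsRetract A (Bimodule.RightDual A A)
        (H.obj (ModuleCat.of B (Bimodule.RightDual B B))) := by
  obtain ⟨M, N, h, ⟨adj⟩, ⟨adj'⟩⟩ := h
  have := h.fg_projective_fst.finite_right
  have := h.fg_projective_fst.projective_right
  obtain ⟨n, i, p, hp⟩ := exists_isRetract_power Bᵐᵒᵖ M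
  let E : (Fin n → Bᵐᵒᵖ) ≃ₗ[Bᵐᵒᵖ] (Fin n → B) :=
    LinearEquiv.piCongrRight fun _ ↦ (opLinearEquiv Bᵐᵒᵖ).symm
  have hn : IsRetract Bᵐᵒᵖ M (Fin n → B) := IsRetract.trans ⟨i, p, hp⟩ (.of_equiv E)
  obtain ⟨X, hX⟩ := h.exists_left
  exact ⟨powerFunctor B n ⋙ M.tensorFunctor,
    (M.tensorFunctor_isHomologicalTransfer N h.fg_projective_fst adj adj').comp
      (powerFunctor_isHomologicalTransfer B n),
    (((M.isRetract_right_regular_tensor N hX).dual (RingEquiv.opOp A)).trans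
      (M.isRetract_rightDual_tensor N adj')).trans
      (((hn.dual (RingEquiv.opOp B)).trans
        (.of_equiv (DualModule.piEquiv (RingEquiv.opOp B) n))).map_functor M.tensorFunctor)⟩

theorem injectiveDimension_le_of_forall {C D : Type*} [Category* C] [Abelian C] [Category* D]
    [Abelian D] {X : C} {Y : D}
    (h : ∀ n, HasInjectiveDimensionLT Y n → HasInjectiveDimensionLT X n) :
    injectiveDimension X ≤ injectiveDimension Y :=
  sInf_le_sInf fun _ hn i hi ↦ h i (hn i hi)

theorem SymmetricallySeparablyEquivalent.leftSelfInjectiveDimension_le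
    (h : SymmetricallySeparablyEquivalent A B) :
    leftSelfInjectiveDimension A ≤ leftSelfInjectiveDimension B := by
  obtain ⟨H, hH, hr⟩ := h.exists_transfer
  exact injectiveDimension_le_of_forall fun n hn ↦
    hr.hasInjectiveDimensionLT (hH.hasInjectiveDimensionLT hn)

theorem hasInjectiveDimensionLT_right_iff (A : Type u) [Ring A] [IsNoetherianRing Aᵐᵒᵖ] (n : ℕ) :
    HasInjectiveDimensionLT (ModuleCat.of Aᵐᵒᵖ A) n ↔
      HasFlatDimensionLT A (Bimodule.RightDual A A) n :=
  (hasInjectiveDimensionLT_double_dual_iff (fun _ ↦ rfl) n).symm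

theorem SymmetricallySeparablyEquivalent.rightSelfInjectiveDimension_le
    [IsNoetherianRing Aᵐᵒᵖ] [IsNoetherianRing Bᵐᵒᵖ] (h : SymmetricallySeparablyEquivalent A B) :
    rightSelfInjectiveDimension A ≤ rightSelfInjectiveDimension B := by
  obtain ⟨H, hH, hr⟩ := h.exists_transfer_rightDual
  refine injectiveDimension_le_of_forall fun n hn ↦ ?_
  rw [hasInjectiveDimensionLT_right_iff] at hn ⊢
  exact hr.hasFlatDimensionLT (hH.hasFlatDimensionLT hn)

end

/-! ## Injective envelopes -/

section

variable {A : Type u} [Ring A]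

/-- For `J` injective, such a maximal essential extension `S` of `V` inside `J` will be the
injective envelope. -/
theorem exists_maximal_essential {J : Type u} [AddCommGroup J] [Module A J] (V : Submodule A J) :
    ∃ S : Submodule A J, V ≤ S ∧ (∀ T ≤ S, V ⊓ T = ⊥ → T = ⊥) ∧
      ∀ S' : Submodule A J, S ≤ S' → (∀ T ≤ S', V ⊓ T = ⊥ → T = ⊥) → S' ≤ S := by
  obtain ⟨S, hVS, hS⟩ := zorn_le_nonempty₀
    {S : Submodule A J | V ≤ S ∧ ∀ T ≤ S, V ⊓ T = ⊥ → T = ⊥}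
    (fun c hc hchain S₀ hS₀ ↦ ⟨sSup c, ⟨(hc hS₀).1.trans (le_sSup hS₀), fun T hT hVT ↦ by
      rw [eq_bot_iff]
      intro x hx
      obtain ⟨S', hS', hxS'⟩ := (Submodule.mem_sSup_of_directed ⟨S₀, hS₀⟩ hchain.directedOn).1
        (hT hx)
      have := (hc hS').2 (T ⊓ S') inf_le_right
        (by rw [← inf_assoc, hVT, bot_inf_eq])
      exact this ▸ (⟨hx, hxS'⟩ : x ∈ T ⊓ S')⟩, fun S hS ↦ le_sSup hS⟩)
    V ⟨le_rfl, fun T hT h ↦ by rwa [inf_eq_right.2 hT] at h⟩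
  exact ⟨S, hVS, hS.prop.2, fun S' h h' ↦ hS.le_of_ge ⟨hVS.trans h, h'⟩ h⟩

theorem exists_maximal_disjoint {J : Type u} [AddCommGroup J] [Module A J] (S : Submodule A J) :
    ∃ T : Submodule A J, T ⊓ S = ⊥ ∧ ∀ T', T ≤ T' → T' ⊓ S = ⊥ → T' ≤ T := by
  obtain ⟨T, -, hT⟩ := zorn_le_nonempty₀ {T : Submodule A J | T ⊓ S = ⊥}
    (fun c hc hchain T₀ hT₀ ↦ ⟨sSup c, by
      change sSup c ⊓ S = ⊥
      rw [eq_bot_iff]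
      rintro x ⟨hx, hxS⟩
      obtain ⟨T', hT', hxT'⟩ := (Submodule.mem_sSup_of_directed ⟨T₀, hT₀⟩ hchain.directedOn).1 hx
      exact (hc hT') ▸ (⟨hxT', hxS⟩ : x ∈ T' ⊓ S), fun S hS ↦ le_sSup hS⟩)
    ⊥ (bot_inf_eq S)
  exact ⟨T, hT.prop, fun T' h h' ↦ hT.le_of_ge h' h⟩

/-- Every module has an injective envelope. -/
theorem exists_injective_envelope (V : Type u) [AddCommGroup V] [Module A V] :
    ∃ (E : ModuleCat.{u} A) (f : V →ₗ[A] E), Module.Injective A E ∧ Function.Injective f ∧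
      f.range.IsEssentialSubmodule := by
  obtain ⟨J, f, hJ, hf⟩ := exists_injective_embedding A V
  obtain ⟨S, hVS, hess, hmax⟩ := exists_maximal_essential f.range
  obtain ⟨T, hTS, hTmax⟩ := exists_maximal_disjoint S
  have hj : Function.Injective (T.mkQ ∘ₗ S.subtype) := by
    rw [injective_iff_map_eq_zero]
    intro x hx
    have hxT : (x : J) ∈ T := (Submodule.Quotient.mk_eq_zero T).1 hx
    have : (x : J) ∈ T ⊓ S := ⟨hxT, x.2⟩
    rw [hTS] at this
    exact Subtype.ext this
  -- `S` embeds in J/T. Once the extension `g` of its inclusion is shown to land in `S`, J → J/T → S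
  -- is a retraction and `S` is injective.
  obtain ⟨g, hg⟩ := hJ.out _ hj S.subtype
  have hgS (x : J) (hx : x ∈ S) : g (T.mkQ x) = x := hg ⟨x, hx⟩
  have hrange : g.range ≤ S := by
    -- By maximality of `S` it suffices that the range of `g` is essential over `V`. If `U` in the
    -- range misses `V`, it misses `S`; its preimage in `J` contains `T` and misses `S`, so it
    -- equals `T` and `U = 0`.
    refine hmax _ (fun x hx ↦ ⟨_, hgS x hx⟩) fun U hU hVU ↦ ?_
    have hUS : U ⊓ S = ⊥ := hess _ inf_le_right (by rw [← inf_assoc, hVU, bot_inf_eq])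
    have hle : (U.comap g).comap T.mkQ ≤ T := by
      refine hTmax _ (fun x hx ↦ ?_) ?_
      · have hx0 : T.mkQ x = 0 := (Submodule.Quotient.mk_eq_zero T).2 hx
        rw [Submodule.mem_comap, hx0]
        exact zero_mem _
      · rw [eq_bot_iff, ← hUS]
        rintro x ⟨hx, hxS⟩
        refine ⟨?_, hxS⟩
        have : g (T.mkQ x) ∈ U := hx
        rwa [hgS x hxS] at this
    rw [eq_bot_iff]
    intro x hx
    obtain ⟨y, rfl⟩ := hU hx
    obtain ⟨z, rfl⟩ := T.mkQ_surjective y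
    have hz : z ∈ T := hle hx
    have : T.mkQ z = 0 := (Submodule.Quotient.mk_eq_zero T).2 hz
    rw [this, map_zero]
    exact zero_mem _
  have hret : IsRetract A S J := by
    refine ⟨S.subtype, (g ∘ₗ T.mkQ).codRestrict S fun x ↦ hrange ⟨_, rfl⟩, ?_⟩
    ext x
    exact hgS x x.2
  refine ⟨ModuleCat.of A S, f.codRestrict S fun x ↦ hVS ⟨x, rfl⟩, hret.injective hJ,
    fun x y h ↦ hf (congrArg Subtype.val h), fun U hU ↦ ?_⟩
  have h := hess (U.map S.subtype) (Submodule.map_subtype_le S U) (by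
    rw [eq_bot_iff]
    rintro _ ⟨⟨v, rfl⟩, ⟨y, hy, hyv⟩⟩
    have : y ∈ (⊥ : Submodule A S) := hU ▸ ⟨⟨v, Subtype.ext hyv.symm⟩, hy⟩
    rw [← hyv, (Submodule.mem_bot A).1 this]
    exact zero_mem _)
  rw [eq_bot_iff]
  intro x hx
  have hx0 : (x : J) ∈ U.map S.subtype := ⟨x, hx, rfl⟩
  rw [h] at hx0
  exact Subtype.ext hx0

/-! ## Minimal injective coresolutions -/

theorem Submodule.IsEssentialSubmodule.injective_of_forall {E W : Type u} [AddCommGroup E] [Module A E]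
    [AddCommGroup W] [Module A W] {K : Submodule A E} (hK : K.IsEssentialSubmodule)
    (f : E →ₗ[A] W) (hf : ∀ x ∈ K, f x = 0 → x = 0) : Function.Injective f := by
  rw [← LinearMap.ker_eq_bot]
  refine hK _ ?_
  rw [eq_bot_iff]
  rintro x ⟨hx, hx'⟩
  exact hf x hx hx'

/-- If an injective module `E` is an envelope of `ker d` and `ker d` is a direct summand of
`ker δ` with `δ` defined on an injective module `J`, then `E` is a direct summand of `J`, and
`range d` one of `range δ`. -/
theorem IsRetract.envelope {E E' J J' : Type u} [AddCommGroup E] [Module A E] [AddCommGroup E']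
    [Module A E'] [AddCommGroup J] [Module A J] [AddCommGroup J'] [Module A J']
    [Module.Injective A E] [Module.Injective A J] {d : E →ₗ[A] E'} {δ : J →ₗ[A] J'}
    (hd : (LinearMap.ker d).IsEssentialSubmodule)
    (h : IsRetract A (LinearMap.ker d) (LinearMap.ker δ)) :
    IsRetract A E J ∧ IsRetract A d.range δ.range := by
  obtain ⟨i, p, hp⟩ := h
  obtain ⟨φ, hφ⟩ := Module.Injective.out (LinearMap.ker d).subtype
    (LinearMap.ker d).injective_subtype ((LinearMap.ker δ).subtype ∘ₗ i)
  obtain ⟨π, hπ⟩ := Module.Injective.out (LinearMap.ker δ).subtype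
    (LinearMap.ker δ).injective_subtype ((LinearMap.ker d).subtype ∘ₗ p)
  have hφK (x : LinearMap.ker d) : φ x = i x := hφ x
  have hπL (x : LinearMap.ker δ) : π x = p x := hπ x
  have hK (x : LinearMap.ker d) : π (φ x) = x := by
    rw [hφK, hπL]
    exact congrArg Subtype.val (LinearMap.congr_fun hp x)
  -- `π ∘ φ` is the identity on the essential submodule `ker d`, hence injective, hence split by
  -- some `r` that also fixes `ker d`.
  have hinj : Function.Injective (π ∘ₗ φ) :=
    hd.injective_of_forall _ fun x hx h ↦ (hK ⟨x, hx⟩).symm.trans h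
  obtain ⟨r, hr⟩ := Module.Injective.out (π ∘ₗ φ) hinj LinearMap.id
  have hrK (x : LinearMap.ker d) : r x = x := by
    have := hr x
    rwa [LinearMap.comp_apply, hK] at this
  have hret : (r ∘ₗ π) ∘ₗ φ = LinearMap.id := LinearMap.ext hr
  refine ⟨⟨φ, r ∘ₗ π, hret⟩, ?_⟩
  have hφ' : LinearMap.ker d ≤ (LinearMap.ker δ).comap φ := fun x hx ↦ by
    rw [Submodule.mem_comap, hφK ⟨x, hx⟩]
    exact (i ⟨x, hx⟩).2
  have hπ' : LinearMap.ker δ ≤ (LinearMap.ker d).comap (r ∘ₗ π) := fun x hx ↦ by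
    rw [Submodule.mem_comap, LinearMap.comp_apply, hπL ⟨x, hx⟩, hrK]
    exact (p ⟨x, hx⟩).2
  -- `φ` and `r ∘ π` respect the kernels, so the splitting descends to the quotients by them, which
  -- are the ranges.
  refine (IsRetract.of_equiv d.quotKerEquivRange.symm).trans
    (IsRetract.trans ⟨Submodule.mapQ _ _ φ hφ', Submodule.mapQ _ _ _ hπ', ?_⟩
      (.of_equiv δ.quotKerEquivRange))
  refine Submodule.linearMap_qext _ (LinearMap.ext fun x ↦ ?_)
  exact congrArg (Submodule.Quotient.mk (p := LinearMap.ker d)) (hr x)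

/-- Induction on cosyzygies: by exactness the next kernel is the current range. Minimality is needed
only for `I`, which matters because a transfer functor need not preserve it. -/
theorem isRetract_of_minimal {I J : ℕ → ModuleCat.{u} A} (d : ∀ n, I n ⟶ I (n + 1))
    (δ : ∀ n, J n ⟶ J (n + 1)) (hI : ∀ n, Module.Injective A (I n))
    (hJ : ∀ n, Module.Injective A (J n)) (hd : ∀ n, Function.Exact (d n).hom (d (n + 1)).hom)
    (hδ : ∀ n, Function.Exact (δ n).hom (δ (n + 1)).hom)
    (hmin : ∀ n, (LinearMap.ker (d n).hom).IsEssentialSubmodule)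
    (h : IsRetract A (LinearMap.ker (d 0).hom) (LinearMap.ker (δ 0).hom)) (n : ℕ) :
    IsRetract A (I n) (J n) := by
  have key (n : ℕ) : IsRetract A (LinearMap.ker (d n).hom) (LinearMap.ker (δ n).hom) := by
    induction n with
    | zero => exact h
    | succ n ih =>
      have := hI n
      have := hJ n
      rw [LinearMap.exact_iff.1 (hd n), LinearMap.exact_iff.1 (hδ n)]
      exact (ih.envelope (hmin n)).2
  have := hI n
  have := hJ n
  exact ((key n).envelope (hmin n)).1

namespace CategoryTheory.InjectiveResolution

variable {V : ModuleCat.{u} A}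

theorem injective_module (I : InjectiveResolution V) (n : ℕ) :
    Module.Injective A (I.cocomplex.X n) :=
  have := I.injective n
  Module.injective_module_of_injective_object A (I.cocomplex.X n)

theorem function_exact (I : InjectiveResolution V) (n : ℕ) :
    Function.Exact (I.cocomplex.d n (n + 1)).hom (I.cocomplex.d (n + 1) (n + 2)).hom :=
  (ShortComplex.ShortExact.moduleCat_exact_iff_function_exact _).1 (I.exact_succ n)

/-- The coaugmentation of an injective resolution. -/
def augmentation (I : InjectiveResolution V) : V ⟶ I.cocomplex.X 0 := I.ι.f 0

theorem augmentation_injective (I : InjectiveResolution V) :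
    Function.Injective I.augmentation.hom :=
  (ModuleCat.mono_iff_injective _).1 (inferInstanceAs (Mono (I.ι.f 0)))

theorem augmentation_exact (I : InjectiveResolution V) :
    Function.Exact I.augmentation.hom (I.cocomplex.d 0 1).hom :=
  (ShortComplex.ShortExact.moduleCat_exact_iff_function_exact _).1 I.exact₀

end CategoryTheory.InjectiveResolution

/-- If `f` is injective and `f`, `g` are exact, the source of `f` is isomorphic to the kernel of `g`. -/
def Function.Exact.equivKer {V W U : Type u} [AddCommGroup V] [Module A V]
    [AddCommGroup W] [Module A W] [AddCommGroup U] [Module A U] {f : V →ₗ[A] W} {g : W →ₗ[A] U}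
    (h : Function.Exact f g) (hf : Function.Injective f) : V ≃ₗ[A] LinearMap.ker g :=
  (LinearEquiv.ofInjective f hf).trans (LinearEquiv.ofEq _ _ (LinearMap.exact_iff.1 h).symm)

variable {B : Type u} [Ring B]

theorem IsHomologicalTransfer.isRetract_minimal {H : ModuleCat.{u} B ⥤ ModuleCat.{u} A}
    (hH : IsHomologicalTransfer H) {V : ModuleCat.{u} A} {W : ModuleCat.{u} B}
    (h : IsRetract A V (H.obj W)) (I : InjectiveResolution V)
    (hI : IsMinimalInjectiveResolution I) (J : InjectiveResolution W) (n : ℕ) :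
    IsRetract A (I.cocomplex.X n) (H.obj (J.cocomplex.X n)) :=
  isRetract_of_minimal (fun n ↦ I.cocomplex.d n (n + 1)) (fun n ↦ H.map (J.cocomplex.d n (n + 1)))
    I.injective_module (fun n ↦ hH.injective _ (J.injective_module n)) I.function_exact
    (fun n ↦ hH.exact _ _ (J.function_exact n)) hI
    (((IsRetract.of_equiv (I.augmentation_exact.equivKer I.augmentation_injective).symm).trans
      h).trans (.of_equiv ((hH.exact _ _ J.augmentation_exact).equivKer
        (hH.map_injective _ J.augmentation_injective)))) n

/-! ### Existence of minimal injective coresolutions -/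

/-- An injective envelope of a module. -/
def injectiveEnvelope (V : ModuleCat.{u} A) : ModuleCat.{u} A :=
  (exists_injective_envelope (A := A) V).choose

/-- The embedding of a module into its injective envelope. -/
def toInjectiveEnvelope (V : ModuleCat.{u} A) : V ⟶ injectiveEnvelope V :=
  ModuleCat.ofHom (exists_injective_envelope (A := A) V).choose_spec.choose

theorem injectiveEnvelope_injective (V : ModuleCat.{u} A) :
    Module.Injective A (injectiveEnvelope V) :=
  (exists_injective_envelope (A := A) V).choose_spec.choose_spec.1

theorem toInjectiveEnvelope_injective (V : ModuleCat.{u} A) :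
    Function.Injective (toInjectiveEnvelope V).hom :=
  (exists_injective_envelope (A := A) V).choose_spec.choose_spec.2.1

theorem toInjectiveEnvelope_essential (V : ModuleCat.{u} A) :
    (toInjectiveEnvelope V).hom.range.IsEssentialSubmodule :=
  (exists_injective_envelope (A := A) V).choose_spec.choose_spec.2.2

/-- The iterated cosyzygies of a module. -/
def cosyzygy (V : ModuleCat.{u} A) : ℕ → ModuleCat.{u} A
  | 0 => V
  | n + 1 => ModuleCat.of A (injectiveEnvelope (cosyzygy V n) ⧸
      (toInjectiveEnvelope (cosyzygy V n)).hom.range)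

/-- The projection from the injective envelope of a cosyzygy to the next cosyzygy. -/
def toCosyzygy (V : ModuleCat.{u} A) (n : ℕ) :
    injectiveEnvelope (cosyzygy V n) ⟶ cosyzygy V (n + 1) :=
  ModuleCat.ofHom (toInjectiveEnvelope (cosyzygy V n)).hom.range.mkQ

theorem toCosyzygy_exact (V : ModuleCat.{u} A) (n : ℕ) :
    Function.Exact (toInjectiveEnvelope (cosyzygy V n)).hom (toCosyzygy V n).hom :=
  LinearMap.exact_map_mkQ_range _

theorem toCosyzygy_surjective (V : ModuleCat.{u} A) (n : ℕ) :
    Function.Surjective (toCosyzygy V n).hom :=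
  Submodule.mkQ_surjective _

/-- The differentials of the minimal injective coresolution. -/
def minimalDifferential (V : ModuleCat.{u} A) (n : ℕ) :
    injectiveEnvelope (cosyzygy V n) ⟶ injectiveEnvelope (cosyzygy V (n + 1)) :=
  toCosyzygy V n ≫ toInjectiveEnvelope (cosyzygy V (n + 1))

theorem minimalDifferential_eq_zero_iff (V : ModuleCat.{u} A) (n : ℕ)
    (x : injectiveEnvelope (cosyzygy V n)) :
    (minimalDifferential V n).hom x = 0 ↔ (toCosyzygy V n).hom x = 0 :=
  map_eq_zero_iff _ (toInjectiveEnvelope_injective _)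

theorem exact_minimalDifferential (V : ModuleCat.{u} A) (n : ℕ) :
    Function.Exact (toInjectiveEnvelope (cosyzygy V n)).hom (minimalDifferential V n).hom :=
  fun x ↦ (minimalDifferential_eq_zero_iff V n x).trans (toCosyzygy_exact V n x)

theorem minimalDifferential_exact (V : ModuleCat.{u} A) (n : ℕ) :
    Function.Exact (minimalDifferential V n).hom (minimalDifferential V (n + 1)).hom := by
  refine fun x ↦ (exact_minimalDifferential V (n + 1) x).trans ⟨?_, ?_⟩
  · rintro ⟨y, rfl⟩
    obtain ⟨z, rfl⟩ := toCosyzygy_surjective V n y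
    exact ⟨z, rfl⟩
  · rintro ⟨z, rfl⟩
    exact ⟨_, rfl⟩

/-- The cocomplex of the minimal injective coresolution. -/
def minimalCocomplex (V : ModuleCat.{u} A) : CochainComplex (ModuleCat.{u} A) ℕ :=
  CochainComplex.of (fun n ↦ injectiveEnvelope (cosyzygy V n)) (minimalDifferential V) fun n ↦ by
    ext x
    exact (minimalDifferential_exact V n).apply_apply_eq_zero x

theorem minimalCocomplex_d (V : ModuleCat.{u} A) (n : ℕ) :
    (minimalCocomplex V).d n (n + 1) = minimalDifferential V n :=
  CochainComplex.of_d (fun n ↦ injectiveEnvelope (cosyzygy V n)) (minimalDifferential V) n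

theorem minimalCocomplex_exactAt (V : ModuleCat.{u} A) (n : ℕ) :
    (minimalCocomplex V).ExactAt (n + 1) := by
  rw [HomologicalComplex.exactAt_iff' _ n (n + 1) (n + 1 + 1) (by simp) (by simp),
    ShortComplex.ShortExact.moduleCat_exact_iff_function_exact]
  change Function.Exact ((minimalCocomplex V).d n (n + 1)).hom
    ((minimalCocomplex V).d (n + 1) (n + 1 + 1)).hom
  rw [minimalCocomplex_d, minimalCocomplex_d]
  exact minimalDifferential_exact V n

/-- A minimal injective coresolution. -/
def minimalInjectiveResolution (V : ModuleCat.{u} A) : InjectiveResolution V where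
  cocomplex := minimalCocomplex V
  injective n := by
    have := injectiveEnvelope_injective (cosyzygy V n)
    exact Module.injective_object_of_injective_module A (injectiveEnvelope (cosyzygy V n))
  ι := (CochainComplex.fromSingle₀Equiv _ _).symm ⟨toInjectiveEnvelope V, by
    rw [minimalCocomplex_d]
    ext x
    exact (exact_minimalDifferential V 0).apply_apply_eq_zero x⟩
  quasiIso := ⟨fun n => by
    cases n
    · rw [CochainComplex.quasiIsoAt₀_iff, ShortComplex.quasiIso_iff_of_zeros]
      · let S : ShortComplex (ModuleCat.{u} A) :=
          ShortComplex.mk (X₂ := injectiveEnvelope (cosyzygy V 0)) (toInjectiveEnvelope V)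
            (minimalDifferential V 0) (by
              ext x
              exact (exact_minimalDifferential V 0).apply_apply_eq_zero x)
        have hS : S.Exact := (ShortComplex.ShortExact.moduleCat_exact_iff_function_exact _).2
          (exact_minimalDifferential V 0)
        have hf : Mono S.f := (ModuleCat.mono_iff_injective _).2 (toInjectiveEnvelope_injective V)
        refine (ShortComplex.exact_and_mono_f_iff_of_iso (S₂ := S) ?_).2 ⟨hS, hf⟩
        refine ShortComplex.isoMk (Iso.refl _) (Iso.refl _) (Iso.refl _) ?_ ?_
        · refine (Category.id_comp _).trans (Eq.trans ?_ (Category.comp_id _).symm)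
          exact (CochainComplex.fromSingle₀Equiv_symm_apply_f_zero (C := minimalCocomplex V)
            (toInjectiveEnvelope V) _).symm
        · refine (Category.id_comp _).trans (Eq.trans ?_ (Category.comp_id _).symm)
          exact (minimalCocomplex_d V 0).symm
      all_goals rfl
    · rw [quasiIsoAt_iff_exactAt]
      · apply minimalCocomplex_exactAt
      · apply CochainComplex.exactAt_succ_single_obj⟩

theorem minimalInjectiveResolution_isMinimal (V : ModuleCat.{u} A) :
    IsMinimalInjectiveResolution (minimalInjectiveResolution V) := by
  intro n
  have h : LinearMap.ker ((minimalInjectiveResolution V).cocomplex.d n (n + 1)).hom =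
      (toInjectiveEnvelope (cosyzygy V n)).hom.range := by
    change LinearMap.ker ((minimalCocomplex V).d n (n + 1)).hom = _
    rw [minimalCocomplex_d]
    exact LinearMap.exact_iff.1 (exact_minimalDifferential V n)
  rw [h]
  exact toInjectiveEnvelope_essential _

end

/-! ## Transfer of the Auslander condition and of the dominant dimension -/

section

variable {A B : Type u} [Ring A] [Ring B]

theorem SymmetricallySeparablyEquivalent.satisfiesAuslanderCondition
    (h : SymmetricallySeparablyEquivalent A B) (hB : SatisfiesAuslanderCondition B) :
    SatisfiesAuslanderCondition A := by
  obtain ⟨H, hH, hr⟩ := h.exists_transfer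
  intro n hn I hI i hi
  -- The condition on `B` quantifies over minimal coresolutions, so one has to exist before it
  -- yields anything.
  have hJ := minimalInjectiveResolution_isMinimal (ModuleCat.of B B)
  have hfd := hB n hn _ hJ i hi
  rw [hasFlatDimensionLE_iff] at hfd ⊢
  exact (hH.isRetract_minimal hr I hI _ i).hasFlatDimensionLT (hH.hasFlatDimensionLT hfd)

theorem dominantDimension_eq_top_iff (A : Type u) [Ring A] : dominantDimension A = ⊤ ↔
    ∀ (n : ℕ) (I : InjectiveResolution (ModuleCat.of A A)), IsMinimalInjectiveResolution I →
      Module.Projective A (I.cocomplex.X n) := by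
  rw [dominantDimension, sInf_eq_top]
  constructor
  · intro h n I hI
    by_contra hn
    exact ENat.natCast_ne_top n (h n ⟨n, I, hI, hn, rfl⟩)
  · rintro h _ ⟨n, I, hI, hn, rfl⟩
    exact absurd (h n I hI) hn

theorem SymmetricallySeparablyEquivalent.dominantDimension_eq_top
    (h : SymmetricallySeparablyEquivalent A B) (hB : dominantDimension B = ⊤) :
    dominantDimension A = ⊤ := by
  obtain ⟨H, hH, hr⟩ := h.exists_transfer
  rw [dominantDimension_eq_top_iff] at hB ⊢
  intro n I hI
  have hJ := minimalInjectiveResolution_isMinimal (ModuleCat.of B B)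
  exact (hH.isRetract_minimal hr I hI _ n).projective (hH.projective _ (hB n _ hJ))

theorem SymmetricallySeparablyEquivalent.injective
    (h : SymmetricallySeparablyEquivalent A B) (hB : Module.Injective B B) :
    Module.Injective A A := by
  obtain ⟨H, hH, hr⟩ := h.exists_transfer
  exact hr.injective (hH.injective _ hB)

end

/-! ## Vanishing of extension groups along an adjunction -/

section

variable {A : Type u} [Ring A]

/-- Phrased as a lifting property, vanishing of Ext¹ can be carried across an adjunction without
comparing Ext groups. -/
theorem subsingleton_ext_one_iff (V : ModuleCat.{u} A) {S : ShortComplex (ModuleCat.{u} A)}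
    (hS : S.ShortExact) [Injective S.X₂] :
    Subsingleton (Abelian.Ext V S.X₁ 1) ↔ ∀ f : V ⟶ S.X₃, ∃ g : V ⟶ S.X₂, g ≫ S.g = f := by
  constructor
  · intro h f
    obtain ⟨x, hx⟩ := Abelian.Ext.covariant_sequence_exact₃ V hS (Abelian.Ext.mk₀ f)
      (zero_add 1) (Subsingleton.elim _ _)
    obtain ⟨g, rfl⟩ := Abelian.Ext.homEquiv₀.symm.surjective x
    refine ⟨g, Abelian.Ext.homEquiv₀.symm.injective ?_⟩
    rw [Abelian.Ext.homEquiv₀_symm_apply, Abelian.Ext.mk₀_comp_mk₀] at hx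
    exact hx
  · intro h
    refine subsingleton_of_forall_eq 0 fun x ↦ ?_
    obtain ⟨y, rfl⟩ := Abelian.Ext.covariant_sequence_exact₁ V hS x
      (Abelian.Ext.eq_zero_of_injective _) (zero_add 1)
    obtain ⟨f, rfl⟩ := Abelian.Ext.homEquiv₀.symm.surjective y
    obtain ⟨g, rfl⟩ := h f
    rw [Abelian.Ext.homEquiv₀_symm_apply, ← Abelian.Ext.mk₀_comp_mk₀,
      Abelian.Ext.comp_assoc_of_second_deg_zero, hS.comp_extClass, Abelian.Ext.comp_zero]

theorem subsingleton_ext_shift_iff (V : ModuleCat.{u} A) {S : ShortComplex (ModuleCat.{u} A)}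
    (hS : S.ShortExact) [Injective S.X₂] (n : ℕ) :
    Subsingleton (Abelian.Ext V S.X₁ (n + 2)) ↔ Subsingleton (Abelian.Ext V S.X₃ (n + 1)) := by
  constructor
  · intro h
    refine subsingleton_of_forall_eq 0 fun x ↦ ?_
    obtain ⟨y, rfl⟩ := Abelian.Ext.covariant_sequence_exact₃ V hS x rfl (Subsingleton.elim _ _)
    rw [Abelian.Ext.eq_zero_of_injective y, Abelian.Ext.zero_comp]
  · intro h
    refine subsingleton_of_forall_eq 0 fun x ↦ ?_
    obtain ⟨y, rfl⟩ := Abelian.Ext.covariant_sequence_exact₁ V hS x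
      (Abelian.Ext.eq_zero_of_injective _) (n₀ := n + 1) rfl
    rw [Subsingleton.elim y 0, Abelian.Ext.zero_comp]

/-- The hypothesis says that `X` is a summand of Yⁿ; every class `x` is then a sum of classes
factoring through Ext(V, Y). -/
theorem subsingleton_ext_of_sum {V X Y : ModuleCat.{u} A} {n i : ℕ} (f : Fin n → (X ⟶ Y))
    (g : Fin n → (Y ⟶ X)) (h : ∑ j, f j ≫ g j = 𝟙 X) (hY : Subsingleton (Abelian.Ext V Y i)) :
    Subsingleton (Abelian.Ext V X i) := by
  refine subsingleton_of_forall_eq 0 fun x ↦ ?_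
  rw [← x.comp_mk₀_id, ← h, Abelian.Ext.mk₀_sum, Abelian.Ext.comp_sum]
  refine Finset.sum_eq_zero fun j _ ↦ ?_
  rw [← Abelian.Ext.mk₀_comp_mk₀, ← Abelian.Ext.comp_assoc_of_second_deg_zero,
    Subsingleton.elim (x.comp (Abelian.Ext.mk₀ (f j)) (add_zero i)) 0, Abelian.Ext.zero_comp]

end

section

variable {A B : Type u} [Ring A] [Ring B]

/-- `G` carries an embedding of `W` in an injective, with its cokernel, to one for `G.obj W`. Both
sides then shift together down to degree 1, where liftings correspond under the adjunction; degree 0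
is the adjunction itself. -/
theorem subsingleton_ext_iff_of_adjunction {F : ModuleCat.{u} B ⥤ ModuleCat.{u} A}
    {G : ModuleCat.{u} A ⥤ ModuleCat.{u} B} (adj : F ⊣ G) (hG : IsHomologicalTransfer G)
    (V : ModuleCat.{u} B) (W : ModuleCat.{u} A) (i : ℕ) :
    Subsingleton (Abelian.Ext (F.obj V) W i) ↔ Subsingleton (Abelian.Ext V (G.obj W) i) := by
  induction i generalizing W with
  | zero =>
    rw [Abelian.Ext.homEquiv₀.subsingleton_congr, (adj.homEquiv V W).subsingleton_congr,
      Abelian.Ext.homEquiv₀.subsingleton_congr]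
  | succ i ih =>
    obtain ⟨J, f, hJ, hf⟩ := exists_injective_embedding A W
    have hex := f.exact_map_mkQ_range
    have hs := Submodule.mkQ_surjective f.range
    let f' : W ⟶ J := ModuleCat.ofHom f
    let q : J ⟶ ModuleCat.of A (J ⧸ f.range) := ModuleCat.ofHom f.range.mkQ
    have hex' := hG.exact f' q hex
    let S : ShortComplex (ModuleCat.{u} A) :=
      ShortComplex.mk f' q (ModuleCat.hom_ext hex.linearMap_comp_eq_zero)
    let S' : ShortComplex (ModuleCat.{u} B) :=
      ShortComplex.mk (G.map f') (G.map q) (ModuleCat.hom_ext hex'.linearMap_comp_eq_zero)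
    have hS : S.ShortExact := ModuleCat.shortComplex_shortExact S hex hf hs
    have hS' : S'.ShortExact := ModuleCat.shortComplex_shortExact S' hex' (hG.map_injective f' hf)
      (hG.map_surjective q hs)
    have : Injective S.X₂ := Module.injective_object_of_injective_module A J
    have hGJ := hG.injective J hJ
    have : Injective S'.X₂ := Module.injective_object_of_injective_module B (G.obj J)
    obtain _ | i := i
    · refine (subsingleton_ext_one_iff _ hS).trans (Iff.trans ?_
        (subsingleton_ext_one_iff V hS').symm)
      constructor
      · intro h φ
        obtain ⟨g, hg⟩ := h ((adj.homEquiv _ _).symm φ)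
        refine ⟨adj.homEquiv _ _ g, ?_⟩
        have h1 := adj.homEquiv_naturality_right g q
        rw [← h1]
        exact (congrArg _ hg).trans ((adj.homEquiv _ _).apply_symm_apply φ)
      · intro h φ
        obtain ⟨g, hg⟩ := h (adj.homEquiv _ _ φ)
        refine ⟨(adj.homEquiv _ _).symm g, ?_⟩
        have h1 := adj.homEquiv_naturality_right_symm g q
        refine h1.symm.trans ?_
        exact (congrArg _ hg).trans ((adj.homEquiv _ _).symm_apply_apply φ)
    · exact ((subsingleton_ext_shift_iff _ hS i).trans (ih _)).trans
        (subsingleton_ext_shift_iff V hS' i).symm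

/-! ## Transfer of the strong Nakayama conjecture -/

namespace Bimodule

theorem finite_tensorFunctor (M : Bimodule A B) [Module.Finite A M] (V : ModuleCat.{u} B)
    [Module.Finite B V] : Module.Finite A (M.tensorFunctor.obj V) := by
  obtain ⟨s, hs⟩ := Module.Finite.fg_top (R := A) (M := M)
  obtain ⟨t, ht⟩ := Module.Finite.fg_top (R := B) (M := V)
  let P : Submodule A (BalancedTensor B M V) :=
    Submodule.span A (Set.image2 (BalancedTensor.tmul B) (s : Set M) (t : Set V))
  have hP : P.FG := Submodule.fg_span (s.finite_toSet.image2 _ t.finite_toSet)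
  suffices h : P = ⊤ from ⟨h ▸ hP⟩
  -- Quantifying over `m` inside the induction lets a scalar on `v` be moved onto `m`.
  have key (v : V) (hv : v ∈ Submodule.span B (t : Set V)) :
      ∀ m : M, BalancedTensor.tmul B m v ∈ P := by
    induction hv using Submodule.span_induction with
    | mem v hv =>
      intro m
      have hm : m ∈ Submodule.span A (s : Set M) := hs ▸ Submodule.mem_top
      induction hm using Submodule.span_induction with
      | mem m hm => exact Submodule.subset_span ⟨m, hm, v, hv, rfl⟩
      | zero =>
        rw [BalancedTensor.zero_tmul]
        exact zero_mem P
      | add x y _ _ hx hy =>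
        rw [BalancedTensor.add_tmul]
        exact add_mem hx hy
      | smul a x _ hx => exact P.smul_mem a hx
    | zero =>
      intro m
      rw [BalancedTensor.tmul_zero]
      exact zero_mem P
    | add x y _ _ hx hy =>
      intro m
      rw [BalancedTensor.tmul_add]
      exact add_mem (hx m) (hy m)
    | smul b x _ hx =>
      intro m
      rw [← BalancedTensor.smul_tmul]
      exact hx _
  rw [eq_top_iff]
  intro x _
  induction x using BalancedTensor.induction_on with
  | tmul m v => exact key v (ht ▸ Submodule.mem_top) m
  | add x y hx hy => exact add_mem (hx trivial) (hy trivial)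

/-- Let `p` be the projection N ⊗ M → B. Right linearity of `p` makes m ⊗ v ↦ p(n ⊗ m) • v well
defined on M ⊗ V = 0, so `p t • v = 0` for all `t`; some `t` has `p t = 1`. -/
theorem subsingleton_of_tensorFunctor (M : Bimodule A B) (N : Bimodule B A) {Y : Bimodule B B}
    (h : (N.tensor M).Isomorphic ((regular B).directSum Y)) (V : ModuleCat.{u} B)
    (hV : Subsingleton (M.tensorFunctor.obj V)) : Subsingleton V := by
  obtain ⟨e, he⟩ := h
  let e' : BalancedTensor A N M ≃ₗ[B] B × Y := e
  let p : BalancedTensor A N M →+ B := (LinearMap.fst B B Y ∘ₗ e'.toLinearMap).toAddMonoidHom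
  have hp (b : B) (n : N) (m : M) : p (BalancedTensor.tmul A n (op b • m)) =
      p (BalancedTensor.tmul A n m) * b :=
    congrArg Prod.fst (he b (BalancedTensor.tmul A n m))
  let β (n : N) : BalancedTensor B M V →+ V := BalancedTensor.lift
    (AddMonoidHom.mk' (fun m ↦ DistribSMul.toAddMonoidHom V (p (BalancedTensor.tmul A n m)))
      (fun m m' ↦ by
        ext v
        change p _ • v = p _ • v + p _ • v
        rw [BalancedTensor.tmul_add, map_add, add_smul]))
    (fun m b v ↦ by
      change p _ • v = p _ • b • v
      rw [hp, mul_smul])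
  have hV' : Subsingleton (BalancedTensor B M V) := hV
  have hzero (t : BalancedTensor A N M) (v : V) : p t • v = 0 := by
    induction t using BalancedTensor.induction_on with
    | tmul n m =>
      change β n (BalancedTensor.tmul B m v) = 0
      rw [Subsingleton.elim (BalancedTensor.tmul B m v) 0, map_zero]
    | add x y hx hy => rw [map_add, add_smul, hx, hy, add_zero]
  refine subsingleton_of_forall_eq 0 fun v ↦ ?_
  have h1 : p (e'.symm (1, 0)) = 1 := congrArg Prod.fst (e'.apply_symm_apply (1, 0))
  have h2 := hzero (e'.symm (1, 0)) v
  rwa [h1, one_smul] at h2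

theorem isRetract_tensorFunctor_regular (N : Bimodule B A) :
    IsRetract B (N.tensorFunctor.obj (ModuleCat.of A A)) N := by
  let i₀ : BalancedTensor A N A →+ N := BalancedTensor.lift
    (AddMonoidHom.mk' (fun n ↦ AddMonoidHom.mk' (fun a ↦ op a • n) (fun a a' ↦ by
        rw [MulOpposite.op_add, add_smul]))
      (fun n n' ↦ by
        ext a
        exact smul_add (op a) n n'))
    (fun n a a' ↦ by
      change op a' • op a • n = op (a * a') • n
      rw [MulOpposite.op_mul, mul_smul])
  let i : BalancedTensor A N A →ₗ[B] N :=
    { toFun := i₀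
      map_add' := map_add _
      map_smul' b t := by
        induction t using BalancedTensor.induction_on with
        | tmul n a => exact (smul_comm b (op a) n).symm
        | add x y hx hy => rw [smul_add, map_add, hx, hy, map_add, smul_add] }
  let p : N →ₗ[B] BalancedTensor A N A :=
    { toFun n := BalancedTensor.tmul A n (1 : A)
      map_add' n n' := BalancedTensor.add_tmul n n' 1
      map_smul' _ _ := rfl }
  refine ⟨i, p, LinearMap.toAddMonoidHom_injective (BalancedTensor.hom_ext fun n a ↦ ?_)⟩
  change BalancedTensor.tmul A (op a • n) (1 : A) = BalancedTensor.tmul A n a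
  rw [BalancedTensor.smul_tmul, smul_eq_mul, mul_one]

end Bimodule

theorem IsRetract.subsingleton_ext {X : ModuleCat.{u} B} {n : ℕ} (h : IsRetract B X (Fin n → B))
    {V : ModuleCat.{u} B} {i : ℕ} (hV : Subsingleton (Abelian.Ext V (ModuleCat.of B B) i)) :
    Subsingleton (Abelian.Ext V X i) := by
  obtain ⟨ι, p, hp⟩ := h
  refine subsingleton_ext_of_sum (fun j ↦ ModuleCat.ofHom (LinearMap.proj j ∘ₗ ι))
    (fun j ↦ ModuleCat.ofHom (p ∘ₗ LinearMap.single B (fun _ ↦ B) j)) ?_ hV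
  ext x
  rw [ModuleCat.hom_sum, LinearMap.sum_apply]
  change ∑ j, p (Pi.single j (ι x j)) = x
  rw [← map_sum, Finset.univ_sum_single]
  exact LinearMap.congr_fun hp x

theorem SymmetricallySeparablyEquivalent.satisfiesStrongNakayamaConjecture
    (h : SymmetricallySeparablyEquivalent A B) (hA : SatisfiesStrongNakayamaConjecture A) :
    SatisfiesStrongNakayamaConjecture B := by
  obtain ⟨M, N, h, ⟨adj⟩, ⟨adj'⟩⟩ := h
  intro V hV hext
  have := h.fg_projective_fst.finite_left
  have := h.fg_projective_snd.finite_left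
  have := h.fg_projective_snd.projective_left
  obtain ⟨n, hn⟩ := exists_isRetract_power B N
  obtain ⟨Y, hY⟩ := h.exists_right
  refine M.subsingleton_of_tensorFunctor N hY V (hA _ (M.finite_tensorFunctor V) fun i ↦ ?_)
  rw [subsingleton_ext_iff_of_adjunction adj
    (N.tensorFunctor_isHomologicalTransfer M h.fg_projective_snd adj' adj)]
  exact (N.isRetract_tensorFunctor_regular.trans hn).subsingleton_ext (hext i)

end

/-! ## The main theorem -/

/-- Artinian commutative rings are noetherian, and so are their module-finite algebras; this enters
only through the double character modules. -/
theorem isNoetherianRing_mulOpposite (R A : Type*) [CommRing R] [IsArtinianRing R] [Ring A]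
    [Algebra R A] [Module.Finite R A] : IsNoetherianRing Aᵐᵒᵖ :=
  have : Module.Finite R Aᵐᵒᵖ := Module.Finite.equiv (opLinearEquiv R)
  isNoetherian_of_tower R inferInstance

end

theorem theorem4p7 {R : Type*} [CommRing R] [IsArtinianRing R] {Λ Γ : Type u}
    [Ring Λ] [Algebra R Λ] [Module.Finite R Λ] [Ring Γ] [Algebra R Γ] [Module.Finite R Γ]
    (h : SymmetricallySeparablyEquivalent Λ Γ) :
    (SatisfiesGorensteinSymmetricConjecture Λ ↔ SatisfiesGorensteinSymmetricConjecture Γ) ∧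
    (SatisfiesStrongNakayamaConjecture Λ ↔ SatisfiesStrongNakayamaConjecture Γ) ∧
    (SatisfiesAuslanderGorensteinConjecture Λ ↔ SatisfiesAuslanderGorensteinConjecture Γ) ∧
    (SatisfiesNakayamaConjecture Λ ↔ SatisfiesNakayamaConjecture Γ) := by
  have := isNoetherianRing_mulOpposite R Λ
  have := isNoetherianRing_mulOpposite R Γ
  have hl : leftSelfInjectiveDimension Λ = leftSelfInjectiveDimension Γ :=
    le_antisymm h.leftSelfInjectiveDimension_le h.symm.leftSelfInjectiveDimension_le
  have hr : rightSelfInjectiveDimension Λ = rightSelfInjectiveDimension Γ :=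
    le_antisymm h.rightSelfInjectiveDimension_le h.symm.rightSelfInjectiveDimension_le
  refine ⟨?_, ⟨h.satisfiesStrongNakayamaConjecture, h.symm.satisfiesStrongNakayamaConjecture⟩,
    ?_, ?_⟩
  · rw [SatisfiesGorensteinSymmetricConjecture, SatisfiesGorensteinSymmetricConjecture, hl, hr]
  · rw [SatisfiesAuslanderGorensteinConjecture, SatisfiesAuslanderGorensteinConjecture,
      IsGorensteinAlgebra, IsGorensteinAlgebra, hl, hr]
    exact imp_congr_left ⟨h.symm.satisfiesAuslanderCondition, h.satisfiesAuslanderCondition⟩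
  · exact imp_congr ⟨h.symm.dominantDimension_eq_top, h.dominantDimension_eq_top⟩
      ⟨h.symm.injective, h.injective⟩
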